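/- Let $n\ge 1$ and let $X$ be a locally compact Hausdorff space. Let $S_n$ (discrete) act on $\mathbb{T}^n$ by $(\sigma\cdot\mu)_j=\mu_{\sigma^{-1}(j)}$, let $\mathbb{T}^n\rtimes S_n$ be the semidirect product for this action, with the topology of $\mathbb{T}^n\times S_n$, and let it act on $\{1,\dots,n\}$ by $(\lambda,\sigma)\cdot i=\sigma(i)$ and on $\{1,\dots,n\}\times\mathbb{C}$ by $(\lambda,\sigma)\cdot(i,z)=(\sigma(i),\lambda_{\sigma(i)}z)$. (a) Let $D_n\subset M_n(\mathbb{C})$ be the diagonal matrices and $\mathcal{U}(N_{D_n})=\{u\in U(n): u^*D_nu\subset D_n,\ uD_nu^*\subset D_n\}$. Sending $(\lambda,\sigma)$ to the matrix with $e_j\mapsto\lambda_{\sigma(j)}e_{\sigma(j)}$ is an isomorphism of topological groups $\mathbb{T}^n\rtimes S_n\cong\mathcal{U}(N_{D_n})$. (b) A twisted $n$-sheeted covering of $X$ is a triple $(Z,s,\mathcal{L})$ with $Z$ a locally compact Hausdorff space, $s:Z\to X$ a surjective covering map all of whose fibers have exactly $n$ points, and $\mathcal{L}$ a Hermitian line bundle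 on $Z$ (a complex line bundle with a continuous metric). Two of them, $(Z,s,\mathcal{L})$ and $(Z',s',\mathcal{L}')$, are isomorphic if there is a homeomorphism $\phi:Z\to Z'$ with $s'\circ\phi=s$ such that $\phi^*\mathcal{L}'$ is isomorphic to $\mathcal{L}$ as a complex line bundle. Principal bundles are assumed locally trivial, with locally compact Hausdorff total space, and their isomorphisms are the equivariant homeomorphisms over $X$. There is a bijection between isomorphism classes of twisted $n$-sheeted coverings of $X$ and isomorphism classes of principal $\mathbb{T}^n\rtimes S_n$-bundles over $X$. Under it, $(Z,s,\mathcal{L})$ corresponds to $\mathcal{P}=(P,p,X)$ if and only if $\mathcal{L}\to Z\to X$ can be identified with the tower of associated bundles $$P\times_{\mathbb{T}^n\rtimes S_n}(\{1,\dots,n\}\times\mathbb{C})\to P\times_{\mathbb{T}^n\rtimes S_n}\{1,\dots,n\}\to X$$ by homeomorphisms of $\mathcal{L}$ and $Z$ that are compatible with the projections, linear on the fibers $\mathbb{C}$, and carry the standard inner product of $\mathbb{C}$ to the metric of $\mathcal{L}$. (c) If $(Z,s,\mathcal{L})$ and $\mathcal{P}$ correspond to each other, then $\mathcal{L}$ is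 trivial if and only if $\mathcal{P}$ reduces to an $S_n$-bundle, that is, there are a principal bundle $Q$ over $X$ for the subgroup $S_n\cong\{1\}\times S_n$ of $\mathbb{T}^n\rtimes S_n$ and an $S_n$-equivariant continuous map $Q\to P$ over $X$. -/

import Mathlib

open Bundle Topology
open scoped ComplexConjugate Matrix

universe u

/-! ### The group `𝕋ⁿ ⋊ Sₙ` and the unitary normalizers of the diagonal -/

/-- `Sₙ` acts on `𝕋ⁿ` by permuting coordinates: `(σ • μ) j = μ (σ⁻¹ j)`. -/
def torusAction (n : ℕ) : Equiv.Perm (Fin n) →* MulAut (Fin n → Circle) where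
  toFun σ :=
    { toFun := fun μ j => μ (σ⁻¹ j)
      invFun := fun μ j => μ (σ j)
      left_inv := fun μ => by ext j; simp
      right_inv := fun μ => by ext j; simp
      map_mul' := fun _ _ => rfl }
  map_one' := by ext μ j; rfl
  map_mul' σ τ := by ext μ j; simp [mul_inv_rev]

/-- The semidirect product `𝕋ⁿ ⋊ Sₙ`, with
`(λ, σ) * (μ, τ) = (λ * (σ • μ), σ * τ)`. -/
abbrev TorusPerm (n : ℕ) : Type := (Fin n → Circle) ⋊[torusAction n] Equiv.Perm (Fin n)

namespace TorusPerm

/-- The topology of `𝕋ⁿ × Sₙ`, where `Sₙ` is discrete. -/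
noncomputable instance (n : ℕ) : TopologicalSpace (TorusPerm n) :=
  TopologicalSpace.induced (fun g => (g.left, g.right))
    (@instTopologicalSpaceProd (Fin n → Circle) (Equiv.Perm (Fin n)) _ ⊥)

theorem torusAction_apply {n : ℕ} (σ : Equiv.Perm (Fin n)) (μ : Fin n → Circle) (j : Fin n) :
    torusAction n σ μ j = μ (σ⁻¹ j) := rfl

theorem continuous_left (n : ℕ) : Continuous (fun g : TorusPerm n => g.left) := by
  let _ : TopologicalSpace (Equiv.Perm (Fin n)) := ⊥
  exact continuous_fst.comp (continuous_induced_dom (f := fun g : TorusPerm n => (g.left, g.right)))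

theorem isLocallyConstant_right (n : ℕ) :
    IsLocallyConstant (fun g : TorusPerm n => g.right) := by
  let _ : TopologicalSpace (Equiv.Perm (Fin n)) := ⊥
  have : DiscreteTopology (Equiv.Perm (Fin n)) := ⟨rfl⟩
  exact (IsLocallyConstant.iff_continuous _).2
    (continuous_snd.comp (continuous_induced_dom (f := fun g : TorusPerm n => (g.left, g.right))))

theorem continuous_of {n : ℕ} {Y : Type*} [TopologicalSpace Y] {f : Y → TorusPerm n}
    (h₁ : Continuous fun y => (f y).left) (h₂ : IsLocallyConstant fun y => (f y).right) :
    Continuous f := by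
  let _ : TopologicalSpace (Equiv.Perm (Fin n)) := ⊥
  exact continuous_induced_rng.2 (h₁.prodMk h₂.continuous)

theorem continuous_eval {n : ℕ} {Y : Type*} [TopologicalSpace Y] {μ : Y → Fin n → Circle}
    {a : Y → Fin n} (h₁ : Continuous μ) (h₂ : IsLocallyConstant a) :
    Continuous fun y => μ y (a y) := by
  refine continuous_iff_continuousAt.2 fun y => ?_
  have h : (fun x => μ x (a y)) =ᶠ[𝓝 y] fun x => μ x (a x) := by
    filter_upwards [(IsLocallyConstant.iff_eventually_eq a).1 h₂ y] with x hx
    rw [hx]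
  exact (((continuous_apply (a y)).comp h₁).continuousAt).congr h

instance (n : ℕ) : IsTopologicalGroup (TorusPerm n) where
  continuous_mul := by
    have hr := isLocallyConstant_right n
    have h1 : IsLocallyConstant fun p : TorusPerm n × TorusPerm n => p.1.right :=
      hr.comp_continuous continuous_fst
    have h2 : IsLocallyConstant fun p : TorusPerm n × TorusPerm n => p.2.right :=
      hr.comp_continuous continuous_snd
    refine continuous_of ?_ (h1.mul h2)
    simp only [SemidirectProduct.mul_left]
    refine ((continuous_left n).comp continuous_fst).mul (continuous_pi fun j => ?_)
    exact continuous_eval (μ := fun p : TorusPerm n × TorusPerm n => p.2.left)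
      (a := fun p => p.1.right⁻¹ j) ((continuous_left n).comp continuous_snd)
      (h1.comp fun σ => σ⁻¹ j)
  continuous_inv := by
    have hr := isLocallyConstant_right n
    refine continuous_of ?_ hr.inv
    simp only [SemidirectProduct.inv_left]
    refine continuous_pi fun j => ?_
    exact continuous_eval (μ := fun g : TorusPerm n => g.left⁻¹)
      (a := fun g => (g.right⁻¹)⁻¹ j) (continuous_left n).inv (hr.comp fun σ => (σ⁻¹)⁻¹ j)

/-- `(λ, σ) • i = σ i`. -/
instance (n : ℕ) : MulAction (TorusPerm n) (Fin n) where
  smul g i := g.right i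
  one_smul _ := rfl
  mul_smul _ _ _ := rfl

/-- `(λ, σ) • (i, z) = (σ i, λ (σ i) * z)`. -/
noncomputable instance (n : ℕ) : MulAction (TorusPerm n) (Fin n × ℂ) where
  smul g p := (g.right p.1, (g.left (g.right p.1) : ℂ) * p.2)
  one_smul p := by
    change ((p.1, ((1 : Circle) : ℂ) * p.2) : Fin n × ℂ) = p
    simp
  mul_smul g h p := by
    change (((g * h).right p.1, ((g * h).left ((g * h).right p.1) : ℂ) * p.2) : Fin n × ℂ) =
      (g.right (h.right p.1),
        (g.left (g.right (h.right p.1)) : ℂ) * ((h.left (h.right p.1) : ℂ) * p.2))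
    simp [torusAction_apply, mul_assoc]

/-- The copy `{1} × Sₙ` of `Sₙ` in `𝕋ⁿ ⋊ Sₙ`. -/
noncomputable def permSubgroup (n : ℕ) : Subgroup (TorusPerm n) :=
  (SemidirectProduct.inr : Equiv.Perm (Fin n) →* TorusPerm n).range

end TorusPerm

/-- The group `{u ∈ U(n) : u* Dₙ u ⊆ Dₙ and u Dₙ u* ⊆ Dₙ}`, where `Dₙ` is the algebra of diagonal
matrices in `Mₙ(ℂ)`. -/
def unitaryNormalizer (n : ℕ) : Subgroup (Matrix.unitaryGroup (Fin n) ℂ) where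
  carrier := {u | ∀ d : Matrix (Fin n) (Fin n) ℂ, d.IsDiag →
    ((u : Matrix (Fin n) (Fin n) ℂ)ᴴ * d * (u : Matrix (Fin n) (Fin n) ℂ)).IsDiag ∧
    ((u : Matrix (Fin n) (Fin n) ℂ) * d * (u : Matrix (Fin n) (Fin n) ℂ)ᴴ).IsDiag}
  mul_mem' := by
    intro u v hu hv d hd
    have h1 := (hv _ (hu d hd).1).1
    have h2 := (hu _ (hv d hd).2).2
    constructor
    · simpa [Matrix.conjTranspose_mul, Matrix.mul_assoc] using h1
    · simpa [Matrix.conjTranspose_mul, Matrix.mul_assoc] using h2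
  one_mem' := by
    intro d hd
    simpa using hd
  inv_mem' := by
    intro u hu d hd
    have h := hu d hd
    have e : ((u⁻¹ : Matrix.unitaryGroup (Fin n) ℂ) : Matrix (Fin n) (Fin n) ℂ) =
      (u : Matrix (Fin n) (Fin n) ℂ)ᴴ := rfl
    rw [e, Matrix.conjTranspose_conjTranspose]
    exact ⟨h.2, h.1⟩

/-! ### Principal bundles -/

/-- A (locally trivial) principal `G`-bundle over `X`: a locally compact Hausdorff space with a
continuous right action of `G` (that is, a left action of `Gᵐᵒᵖ`) over `X` which locally over `X`
is equivariantly isomorphic to `U × G` with `G` acting by right translation. -/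
structure PrincipalBundle (G : Type*) [Group G] [TopologicalSpace G] [IsTopologicalGroup G]
    (X : Type u) [TopologicalSpace X] where
  /-- the total space -/
  P : Type u
  [top : TopologicalSpace P]
  [lc : LocallyCompactSpace P]
  [t2 : T2Space P]
  [act : MulAction Gᵐᵒᵖ P]
  [cont : ContinuousSMul Gᵐᵒᵖ P]
  /-- the bundle projection -/
  proj : P → X
  proj_smul : ∀ (g : G) (a : P), proj (MulOpposite.op g • a) = proj a
  locallyTrivial : ∀ x : X, ∃ e : Trivialization G proj, x ∈ e.baseSet ∧
    ∀ (g : G) (a : P), proj a ∈ e.baseSet →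
      (e (MulOpposite.op g • a)).2 = (e a).2 * g

namespace PrincipalBundle

attribute [instance] top lc t2 act cont

variable {G : Type*} [Group G] [TopologicalSpace G] [IsTopologicalGroup G]
  {X : Type u} [TopologicalSpace X]

/-- Isomorphism of principal bundles: a `G`-equivariant homeomorphism over `X`. -/
def Iso (A B : PrincipalBundle G X) : Prop :=
  ∃ f : A.P ≃ₜ B.P, (∀ a, B.proj (f a) = A.proj a) ∧
    ∀ (g : G) (a : A.P), f (MulOpposite.op g • a) = MulOpposite.op g • f a

variable (G X) in
/-- Isomorphism of principal `G`-bundles over `X` as an equivalence relation. -/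
instance isoSetoid : Setoid (PrincipalBundle G X) where
  r := Iso
  iseqv :=
    { refl := fun A => ⟨Homeomorph.refl _, fun _ => rfl, fun _ _ => rfl⟩
      symm := by
        rintro A B ⟨f, h₁, h₂⟩
        refine ⟨f.symm, fun b => ?_, fun g b => ?_⟩
        · rw [← h₁, f.apply_symm_apply]
        · rw [f.symm_apply_eq, h₂, f.apply_symm_apply]
      trans := by
        rintro A B C ⟨f, h₁, h₂⟩ ⟨f', h₁', h₂'⟩
        refine ⟨f.trans f', fun a => ?_, fun g a => ?_⟩
        · simp [h₁, h₁']
        · simp [h₂, h₂'] }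

/-- The bundle reduces to the subgroup `H`: there is a principal `H`-bundle `Q` over `X` with an
`H`-equivariant continuous map over `X` to the given bundle. -/
def ReducesTo (A : PrincipalBundle G X) (H : Subgroup G) : Prop :=
  ∃ (Q : PrincipalBundle H X) (f : Q.P → A.P), Continuous f ∧ (∀ q, A.proj (f q) = Q.proj q) ∧
    ∀ (h : H) (q : Q.P), f (MulOpposite.op h • q) = MulOpposite.op (h : G) • f q

/-- The total space `P ×_G F` of the associated fiber bundle with fiber `F`: the quotient of
`P × F` by the relation identifying `(a, t)` with `(a g, g⁻¹ t)`. -/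
def Assoc (A : PrincipalBundle G X) (F : Type*) [MulAction G F] :=
  Quot fun p q : A.P × F => ∃ g : G, q = (MulOpposite.op g • p.1, g⁻¹ • p.2)

/-- The class of `(a, t)` in `P ×_G F`. -/
def Assoc.mk (A : PrincipalBundle G X) {F : Type*} [MulAction G F] (a : A.P) (t : F) : A.Assoc F :=
  Quot.mk _ (a, t)

instance (A : PrincipalBundle G X) (F : Type*) [TopologicalSpace F] [MulAction G F] :
    TopologicalSpace (A.Assoc F) :=
  inferInstanceAs (TopologicalSpace (Quot _))

end PrincipalBundle

/-! ### Hermitian line bundles -/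

/-- A complex line bundle over `Z` together with a metric, i.e. an inner product on every fiber
(conjugate-linear in the first variable) which is continuous on the total space of `E ⊕ E`. -/
structure HermitianLineBundle (Z : Type u) [TopologicalSpace Z] where
  /-- the fibers -/
  E : Z → Type u
  [addCommGroup : ∀ z, AddCommGroup (E z)]
  [module : ∀ z, Module ℂ (E z)]
  [fiberTop : ∀ z, TopologicalSpace (E z)]
  [totalTop : TopologicalSpace (TotalSpace ℂ E)]
  [fiberBundle : FiberBundle ℂ E]
  [vectorBundle : VectorBundle ℂ ℂ E]
  /-- the metric -/
  metric : ∀ z, E z →ₗ⋆[ℂ] E z →ₗ[ℂ] ℂ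
  metric_symm : ∀ z (v w : E z), conj (metric z v w) = metric z w v
  metric_pos : ∀ z (v : E z), v ≠ 0 → 0 < (metric z v v).re
  metric_continuous :
    Continuous fun v : TotalSpace (ℂ × ℂ) (E ×ᵇ E) => metric v.proj v.2.1 v.2.2

attribute [instance] HermitianLineBundle.addCommGroup HermitianLineBundle.module
  HermitianLineBundle.fiberTop HermitianLineBundle.totalTop HermitianLineBundle.fiberBundle
  HermitianLineBundle.vectorBundle

/-- Isomorphism of complex line bundles over `Z`: a family of linear isomorphisms of the fibers
inducing a homeomorphism of the total spaces. -/
def LineBundleIsomorphic {Z : Type*} (E E' : Z → Type*)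
    [∀ z, AddCommMonoid (E z)] [∀ z, Module ℂ (E z)] [TopologicalSpace (TotalSpace ℂ E)]
    [∀ z, AddCommMonoid (E' z)] [∀ z, Module ℂ (E' z)] [TopologicalSpace (TotalSpace ℂ E')] :
    Prop :=
  ∃ ℓ : ∀ z, E z ≃ₗ[ℂ] E' z,
    (Continuous fun v : TotalSpace ℂ E => (⟨v.proj, ℓ v.proj v.2⟩ : TotalSpace ℂ E')) ∧
    Continuous fun v : TotalSpace ℂ E' => (⟨v.proj, (ℓ v.proj).symm v.2⟩ : TotalSpace ℂ E)

/-! ### Twisted coverings -/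

/-- A twisted `n`-sheeted covering `(Z, s, L)` of `X`. -/
structure TwistedCovering (n : ℕ) (X : Type u) [TopologicalSpace X] where
  /-- the covering space -/
  Z : Type u
  [top : TopologicalSpace Z]
  [lc : LocallyCompactSpace Z]
  [t2 : T2Space Z]
  /-- the covering map -/
  s : Z → X
  isCoveringMap : IsCoveringMap s
  surjective : Function.Surjective s
  sheets : ∀ x, (s ⁻¹' {x}).encard = n
  /-- the twist -/
  L : HermitianLineBundle Z

namespace TwistedCovering

attribute [instance] top lc t2

variable {n : ℕ} {X : Type u} [TopologicalSpace X]

/-- Isomorphism of twisted coverings: a homeomorphism `φ` over `X` of the covering spaces such that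
the pullback `φ^* L'` is isomorphic to `L`. -/
def Iso (S T : TwistedCovering n X) : Prop :=
  ∃ φ : S.Z ≃ₜ T.Z, (∀ z, T.s (φ z) = S.s z) ∧ LineBundleIsomorphic S.L.E (φ *ᵖ T.L.E)

/-- The same, in terms of a homeomorphism of the total spaces of the line bundles. -/
theorem iso_iff (S T : TwistedCovering n X) : S.Iso T ↔
    ∃ φ : S.Z ≃ₜ T.Z, (∀ z, T.s (φ z) = S.s z) ∧
      ∃ f : TotalSpace ℂ S.L.E ≃ₜ TotalSpace ℂ T.L.E,
        ∀ z, ∃ ℓ : S.L.E z ≃ₗ[ℂ] T.L.E (φ z), ∀ v, f ⟨z, v⟩ = ⟨φ z, ℓ v⟩ := by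
  have key : ∀ φ : S.Z ≃ₜ T.Z, IsInducing
      (Pullback.lift (F := ℂ) (E := T.L.E) φ : TotalSpace ℂ (φ *ᵖ T.L.E) → _) := fun φ =>
    ⟨by
      refine le_antisymm (Pullback.continuous_lift ℂ T.L.E φ).le_induced ?_
      have h : (TotalSpace.proj : TotalSpace ℂ (φ *ᵖ T.L.E) → S.Z) =
          φ.symm ∘ (TotalSpace.proj : TotalSpace ℂ T.L.E → T.Z) ∘ Pullback.lift φ := by
        ext v; simp
      rw [Pullback.TotalSpace.topologicalSpace, pullbackTopology_def]
      refine le_inf ?_ le_rfl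
      rw [h, ← Function.comp_assoc, ← induced_compose]
      exact induced_mono (continuous_iff_le_induced.1
        (φ.symm.continuous.comp (FiberBundle.continuous_proj ℂ T.L.E)))⟩
  constructor
  · rintro ⟨φ, hs, ℓ, h₁, h₂⟩
    have hbij : Function.Bijective
        (Pullback.lift (F := ℂ) (E := T.L.E) φ : TotalSpace ℂ (φ *ᵖ T.L.E) → _) := by
      constructor
      · rintro ⟨z, v⟩ ⟨z', v'⟩ h
        have hz : z = z' := φ.injective (congrArg TotalSpace.proj h)
        subst hz
        have hv : v = v' := eq_of_heq (TotalSpace.mk.inj h).2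
        rw [hv]
      · rintro ⟨w, v⟩
        obtain ⟨z, rfl⟩ := φ.surjective w
        exact ⟨⟨z, v⟩, rfl⟩
    let f₁ : TotalSpace ℂ S.L.E ≃ₜ TotalSpace ℂ (φ *ᵖ T.L.E) :=
      { toFun := fun v => ⟨v.proj, ℓ v.proj v.2⟩
        invFun := fun v => ⟨v.proj, (ℓ v.proj).symm v.2⟩
        left_inv := fun v => by simp
        right_inv := fun v => by simp
        continuous_toFun := h₁
        continuous_invFun := h₂ }
    let f₂ := (Equiv.ofBijective _ hbij).toHomeomorphOfIsInducing (key φ)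
    exact ⟨φ, hs, f₁.trans f₂, fun z => ⟨ℓ z, fun v => rfl⟩⟩
  · rintro ⟨φ, hs, f, hf⟩
    choose ℓ hℓ using hf
    refine ⟨φ, hs, ℓ, ?_, ?_⟩
    · rw [(key φ).continuous_iff]
      refine f.continuous.congr ?_
      rintro ⟨z, v⟩
      exact hℓ z v
    · refine (f.symm.continuous.comp (Pullback.continuous_lift ℂ T.L.E φ)).congr ?_
      rintro ⟨z, v⟩
      refine (f.symm_apply_eq).2 ?_
      exact ((hℓ z _).trans (congrArg (TotalSpace.mk (φ z)) ((ℓ z).apply_symm_apply v))).symm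

variable (n X) in
/-- Isomorphism of twisted `n`-sheeted coverings of `X` as an equivalence relation. -/
instance isoSetoid : Setoid (TwistedCovering n X) where
  r := Iso
  iseqv :=
    { refl := fun S => (iso_iff S S).2 ⟨Homeomorph.refl _, fun _ => rfl, Homeomorph.refl _,
        fun z => ⟨LinearEquiv.refl ℂ _, fun _ => rfl⟩⟩
      symm := by
        intro S T h
        obtain ⟨φ, hs, f, hf⟩ := (iso_iff S T).1 h
        refine (iso_iff T S).2 ⟨φ.symm, fun w => ?_, f.symm, fun w => ?_⟩
        · rw [← hs, φ.apply_symm_apply]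
        · obtain ⟨z, rfl⟩ := φ.surjective w
          have aux : ∀ y, z = y → ∃ ℓ : T.L.E (φ z) ≃ₗ[ℂ] S.L.E y,
              ∀ v, f.symm ⟨φ z, v⟩ = ⟨y, ℓ v⟩ := by
            rintro _ rfl
            obtain ⟨ℓ, hℓ⟩ := hf z
            exact ⟨ℓ.symm, fun v => by rw [f.symm_apply_eq, hℓ, ℓ.apply_symm_apply]⟩
          exact aux _ (φ.symm_apply_apply z).symm
      trans := by
        intro S T U h h'
        obtain ⟨φ, hs, f, hf⟩ := (iso_iff S T).1 h
        obtain ⟨φ', hs', f', hf'⟩ := (iso_iff T U).1 h'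
        refine (iso_iff S U).2 ⟨φ.trans φ', fun z => ?_, f.trans f', fun z => ?_⟩
        · simp [hs, hs']
        · obtain ⟨ℓ, hℓ⟩ := hf z
          obtain ⟨ℓ', hℓ'⟩ := hf' (φ z)
          exact ⟨ℓ.trans ℓ', fun v => (congrArg f' (hℓ v)).trans (hℓ' _)⟩ }

/-- The twist is trivial: `L` is isomorphic to the product bundle `Z × ℂ`. -/
def TwistTrivial (T : TwistedCovering n X) : Prop :=
  LineBundleIsomorphic T.L.E (Bundle.Trivial T.Z ℂ)

/-- `(Z, s, L)` is the twisted covering associated to the principal bundle `A`: the tower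
`L → Z → X` is identified with
`A ×_G ({1, …, n} × ℂ) → A ×_G {1, …, n} → X`, where `G = 𝕋ⁿ ⋊ Sₙ`.
The identification `k` of the line bundles covers the identification `h` of the coverings; on the
fiber over `h [a, i]` it is the map `w ↦ w • u` for a unit vector `u`, i.e. it is linear and carries
the standard inner product of `ℂ` to the metric of `L`. -/
def IsAssociatedTo (T : TwistedCovering n X) (A : PrincipalBundle (TorusPerm n) X) : Prop :=
  ∃ (h : A.Assoc (Fin n) ≃ₜ T.Z) (k : A.Assoc (Fin n × ℂ) ≃ₜ TotalSpace ℂ T.L.E),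
    (∀ a (i : Fin n), T.s (h (.mk A a i)) = A.proj a) ∧
    ∀ a (i : Fin n), ∃ u : T.L.E (h (.mk A a i)), T.L.metric _ u u = 1 ∧
      ∀ w : ℂ, k (.mk A a (i, w)) = ⟨h (.mk A a i), w • u⟩

end TwistedCovering

/-! ### The topological group `𝕋ⁿ ⋊ Sₙ` -/

/-! Write `G` for `𝕋ⁿ ⋊ Sₙ`. For (a), let u normalize the diagonal matrices. Conjugating the matrix
unit E_jj by u gives the matrix with entries u_ij · conj u_kj; it is diagonal only if column j has
at most one nonzero entry. Unitarity then makes u a monomial matrix with entries of modulus one. The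
resulting continuous bijection goes from a compact to a Hausdorff space, so it is a homeomorphism.

For (b), the inverse of the associated-bundle construction is the frame bundle. A frame over x
numbers the fiber of Z over x and picks a unit vector in the line over each of its points. Two
frames over x differ by exactly one element of `G`: a permutation of the numbering and n phases.
This element depends continuously on the frames, and local frames exist, so the frames form a
principal bundle. Evaluation [f, (i, w)] ↦ w · f(i) identifies its associated tower with L → Z → X
(`isAssociatedTo_frameBundle`). Conversely, an identification of the tower of a bundle A with L → Z
→ X sends a point a to the frame of the vectors [a, (i, 1)]; this map is equivariant, hence an
isomorphism (`IsAssociatedTo.iso_frameBundle`). So T is associated to A exactly when A is isomorphic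
to the frame bundle of T. Isomorphisms of line bundles need not be isometric, but normalizing the
images of unit vectors still gives a map of frames. Injectivity on classes holds because two
coverings associated to the same bundle are isomorphic; surjectivity because the associated tower of
A is itself a twisted covering (`isAssociatedTo_twistedCovering`).

For (c), L is trivial exactly when it has a global unit section. Comparing such a section with the
vectors [a, (i, 1)] gives n phases, and the points where all of them are 1 form the reduction to Sₙ.
Conversely, over a reduction the vectors [a, (i, 1)] depend only on the point [a, i] of Z, and so
define a global unit section. -/

theorem continuous_circle_coe : Continuous fun z : Circle => (z : ℂ) := continuous_induced_dom

namespace TorusPerm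

theorem smul_fin_def {n : ℕ} (g : TorusPerm n) (i : Fin n) : g • i = g.right i := rfl

theorem smul_prod_def {n : ℕ} (g : TorusPerm n) (p : Fin n × ℂ) :
    g • p = (g.right p.1, (g.left (g.right p.1) : ℂ) * p.2) := rfl

theorem compactSpace_and_t2Space (n : ℕ) : CompactSpace (TorusPerm n) ∧ T2Space (TorusPerm n) := by
  let _ : TopologicalSpace (Equiv.Perm (Fin n)) := ⊥
  have : DiscreteTopology (Equiv.Perm (Fin n)) := ⟨rfl⟩
  let e : TorusPerm n ≃ₜ (Fin n → Circle) × Equiv.Perm (Fin n) :=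
    SemidirectProduct.equivProd.toHomeomorphOfIsInducing ⟨rfl⟩
  exact ⟨e.symm.compactSpace, e.symm.t2Space⟩

instance (n : ℕ) : CompactSpace (TorusPerm n) := (compactSpace_and_t2Space n).1

instance (n : ℕ) : T2Space (TorusPerm n) := (compactSpace_and_t2Space n).2

instance (n : ℕ) : ContinuousSMul (TorusPerm n) (Fin n) where
  continuous_smul := by
    have h1 := (isLocallyConstant_right n).comp_continuous
      (continuous_fst : Continuous (Prod.fst : TorusPerm n × Fin n → _))
    have h2 : IsLocallyConstant (Prod.snd : TorusPerm n × Fin n → Fin n) :=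
      (IsLocallyConstant.iff_continuous _).2 continuous_snd
    exact (h1.comp₂ h2 fun σ i => σ i).continuous

instance (n : ℕ) : ContinuousSMul (TorusPerm n) (Fin n × ℂ) where
  continuous_smul := by
    have h : Continuous fun p : TorusPerm n × (Fin n × ℂ) => p.1 • p.2.1 := by fun_prop
    refine h.prodMk (Continuous.mul (continuous_circle_coe.comp ?_) (by fun_prop))
    exact continuous_eval (μ := fun p : TorusPerm n × (Fin n × ℂ) => p.1.left)
      ((continuous_left n).comp continuous_fst) ((IsLocallyConstant.iff_continuous _).2 h)

theorem inv_left_apply {n : ℕ} (g : TorusPerm n) (i : Fin n) :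
    g⁻¹.left i = (g.left (g.right i))⁻¹ := rfl

/-- The monomial matrix `e_j ↦ λ (σ j) e_(σ j)` of `(λ, σ)`. -/
noncomputable def toMatrix (n : ℕ) : TorusPerm n →* Matrix (Fin n) (Fin n) ℂ where
  toFun g := Matrix.of fun i j => if i = g.right j then (g.left i : ℂ) else 0
  map_one' := by
    ext i j
    change (if i = j then ((1 : Circle) : ℂ) else 0) = _
    rw [Matrix.one_apply, Circle.coe_one]
  map_mul' g h := by
    ext i j
    rw [Matrix.mul_apply, Finset.sum_eq_single (h.right j)]
    · by_cases hij : i = g.right (h.right j)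
      · simp [hij, torusAction_apply]
      · simp [hij]
    · intro k _ hk
      simp [hk]
    · simp

theorem toMatrix_apply {n : ℕ} (g : TorusPerm n) (i j : Fin n) :
    toMatrix n g i j = if i = g.right j then (g.left i : ℂ) else 0 := rfl

theorem toMatrix_inv {n : ℕ} (g : TorusPerm n) : toMatrix n g⁻¹ = (toMatrix n g)ᴴ := by
  ext i j
  rw [Matrix.conjTranspose_apply, toMatrix_apply, toMatrix_apply]
  by_cases h : j = g.right i
  · rw [inv_left_apply, if_pos (by simp [h]), if_pos h, h, Circle.coe_inv_eq_conj]
    rfl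
  · rw [if_neg h, if_neg fun e => h (by simp [e]), star_zero]

/-- A summand of the entry (i, k) is nonzero only for an index j that `g` sends both to i and to k.
The inverse stands in place of the adjoint so that `g⁻¹` gives the other half of the normalizer
condition. -/
theorem isDiag_conj_toMatrix {n : ℕ} (g : TorusPerm n) {d : Matrix (Fin n) (Fin n) ℂ}
    (hd : d.IsDiag) : (toMatrix n g * d * toMatrix n g⁻¹).IsDiag := by
  intro i k hik
  rw [← hd.diagonal_diag, Matrix.mul_apply]
  refine Finset.sum_eq_zero fun j _ => ?_
  rw [Matrix.mul_diagonal, toMatrix_apply, toMatrix_apply]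
  by_cases h1 : i = g.right j
  · refine mul_eq_zero_of_right _ (if_neg ?_)
    rintro rfl
    exact hik (by simp [h1])
  · simp [h1]

theorem toMatrix_mem_unitaryGroup {n : ℕ} (g : TorusPerm n) :
    toMatrix n g ∈ Matrix.unitaryGroup (Fin n) ℂ := by
  rw [Matrix.mem_unitaryGroup_iff, Matrix.star_eq_conjTranspose, ← toMatrix_inv, ← map_mul,
    mul_inv_cancel, map_one]

/-- `𝕋ⁿ ⋊ Sₙ → 𝒰(N_{Dₙ})`. -/
noncomputable def toNormalizer (n : ℕ) : TorusPerm n →* unitaryNormalizer n :=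
  ((toMatrix n).codRestrict (Matrix.unitaryGroup (Fin n) ℂ) toMatrix_mem_unitaryGroup).codRestrict
    (unitaryNormalizer n) fun g d hd => by
      change ((toMatrix n g)ᴴ * d * toMatrix n g).IsDiag ∧
        (toMatrix n g * d * (toMatrix n g)ᴴ).IsDiag
      rw [← toMatrix_inv]
      refine ⟨?_, isDiag_conj_toMatrix g hd⟩
      simpa using isDiag_conj_toMatrix g⁻¹ hd

theorem coe_toNormalizer {n : ℕ} (g : TorusPerm n) :
    ((toNormalizer n g : Matrix.unitaryGroup (Fin n) ℂ) : Matrix (Fin n) (Fin n) ℂ) =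
      toMatrix n g := rfl

theorem toNormalizer_injective (n : ℕ) : Function.Injective (toNormalizer n) := by
  refine (injective_iff_map_eq_one _).2 fun g hg => ?_
  have h : toMatrix n g = 1 := by rw [← coe_toNormalizer, hg]; rfl
  have hr : ∀ j, g.right j = j := fun j => by
    by_contra hne
    have := congrFun (congrFun h (g.right j)) j
    rw [toMatrix_apply, if_pos rfl, Matrix.one_apply_ne hne] at this
    exact Circle.coe_ne_zero _ this
  refine SemidirectProduct.ext (funext fun j => ?_) (Equiv.ext hr)
  have := congrFun (congrFun h j) j
  rw [toMatrix_apply, if_pos (hr j).symm, Matrix.one_apply_eq] at this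
  exact Circle.ext this

/-- Conjugates of the matrix units E_jj show that a column has at most one nonzero entry, in row σ
j; unit length of the columns makes it a phase, and orthogonality of distinct columns makes σ
injective. -/
theorem toNormalizer_surjective (n : ℕ) : Function.Surjective (toNormalizer n) := by
  rintro ⟨⟨u, hu⟩, hN⟩
  have hN' : ∀ j i k, i ≠ k → u i j * conj (u k j) = 0 := by
    intro j i k hik
    have h : (u * Matrix.diagonal (Pi.single j 1) * uᴴ : Matrix (Fin n) (Fin n) ℂ) i k = 0 :=
      (hN (Matrix.diagonal (Pi.single j 1)) (Matrix.isDiag_diagonal _)).2 hik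
    rw [Matrix.mul_apply, Finset.sum_eq_single j] at h
    · simpa [Matrix.mul_diagonal] using h
    · intro b _ hb
      simp [Matrix.mul_diagonal, hb]
    · simp
  have hcol : ∀ j l, ∑ i, conj (u i j) * u i l = (1 : Matrix (Fin n) (Fin n) ℂ) j l := fun j l => by
    rw [← Matrix.mem_unitaryGroup_iff'.1 hu, Matrix.mul_apply]
    rfl
  have hex : ∀ j, ∃ i, u i j ≠ 0 := fun j => by
    by_contra! h
    have := hcol j j
    simp [h] at this
  choose σ hσ using hex
  have h0 : ∀ i j, i ≠ σ j → u i j = 0 := fun i j hij =>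
    (mul_eq_zero.1 (hN' j i (σ j) hij)).resolve_right
      ((map_ne_zero (starRingEnd ℂ)).2 (hσ j))
  have hsum : ∀ j l, conj (u (σ j) j) * u (σ j) l = (1 : Matrix (Fin n) (Fin n) ℂ) j l :=
    fun j l => by
      rw [← hcol, Finset.sum_eq_single (σ j)]
      · intro i _ hi
        simp [h0 i j hi]
      · simp
  have hinj : Function.Injective σ := fun j l hjl => by
    by_contra hne
    have := hsum j l
    rw [Matrix.one_apply_ne hne, mul_eq_zero, map_eq_zero] at this
    exact this.elim (hσ j) (hjl ▸ hσ l)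
  let τ : Equiv.Perm (Fin n) := Equiv.ofBijective σ (Finite.injective_iff_bijective.1 hinj)
  have hτ : ∀ i, σ (τ.symm i) = i := τ.apply_symm_apply
  have hnorm : ∀ i, u i (τ.symm i) ∈ Submonoid.unitSphere ℂ := fun i => by
    have := hsum (τ.symm i) (τ.symm i)
    rw [hτ, Matrix.one_apply_eq, ← Complex.normSq_eq_conj_mul_self, Complex.normSq_eq_norm_sq,
      Complex.ofReal_eq_one] at this
    refine mem_sphere_zero_iff_norm.2 ((pow_eq_one_iff_of_nonneg (norm_nonneg _) two_ne_zero).1 ?_)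
    exact_mod_cast this
  refine ⟨⟨fun i => ⟨u i (τ.symm i), hnorm i⟩, τ⟩, Subtype.ext (Subtype.ext ?_)⟩
  ext i j
  rw [coe_toNormalizer, toMatrix_apply]
  split_ifs with h
  · subst h
    simp
  · exact (h0 i j h).symm

theorem continuous_toMatrix (n : ℕ) : Continuous (toMatrix n) := by
  refine continuous_matrix fun i j => ?_
  simp only [toMatrix_apply]
  have h : IsLocallyConstant fun g : TorusPerm n => (if i = g.right j then 1 else 0 : ℂ) :=
    (isLocallyConstant_right n).comp fun σ => if i = σ j then (1 : ℂ) else 0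
  have := h.continuous.mul
    (continuous_circle_coe.comp ((continuous_apply i).comp (continuous_left n)))
  refine this.congr fun g => ?_
  simp

/-- `𝕋ⁿ ⋊ Sₙ ≅ 𝒰(N_{Dₙ})` as topological groups. -/
noncomputable def equivNormalizer (n : ℕ) : TorusPerm n ≃ₜ* unitaryNormalizer n :=
  let e := MulEquiv.ofBijective (toNormalizer n)
    ⟨toNormalizer_injective n, toNormalizer_surjective n⟩
  have he : Continuous e := ((continuous_toMatrix n).subtype_mk _).subtype_mk _
  { e with
    continuous_toFun := he
    continuous_invFun := he.continuous_symm_of_equiv_compact_to_t2 }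

end TorusPerm

/-! ### Locally trivial maps -/

section LocallyTrivial

variable {P X F : Type*} [TopologicalSpace P] [TopologicalSpace X] [TopologicalSpace F]
  {proj : P → X}

theorem continuous_proj_of_trivializations
    (h : ∀ x, ∃ e : Trivialization F proj, x ∈ e.baseSet) : Continuous proj :=
  continuous_iff_continuousAt.2 fun a =>
    let ⟨e, he⟩ := h (proj a)
    e.continuousAt_proj (e.mem_source.2 he)

/-- Points of one fiber are separated inside a trivialization, points of different fibers by their
projections. -/
theorem t2Space_of_trivializations [T2Space X] [T2Space F]
    (h : ∀ x, ∃ e : Trivialization F proj, x ∈ e.baseSet) : T2Space P := by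
  refine ⟨fun a b hab => ?_⟩
  by_cases hp : proj a = proj b
  · obtain ⟨e, he⟩ := h (proj a)
    have ha : a ∈ e.source := e.mem_source.2 he
    have hb : b ∈ e.source := e.mem_source.2 (hp ▸ he)
    obtain ⟨U, V, hU, hV, haU, hbV, hUV⟩ := t2_separation (e.injOn.ne ha hb hab)
    refine ⟨e.source ∩ e ⁻¹' U, e.source ∩ e ⁻¹' V, e.continuousOn_toFun.isOpen_inter_preimage
      e.open_source hU, e.continuousOn_toFun.isOpen_inter_preimage e.open_source hV, ⟨ha, haU⟩,
      ⟨hb, hbV⟩, ?_⟩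
    exact (hUV.preimage e).mono Set.inter_subset_right Set.inter_subset_right
  · exact separated_by_continuous (continuous_proj_of_trivializations h) hp

theorem locallyCompactSpace_of_trivializations [LocallyCompactSpace X] [LocallyCompactSpace F]
    (h : ∀ x, ∃ e : Trivialization F proj, x ∈ e.baseSet) : LocallyCompactSpace P := by
  choose e he using h
  -- The trivializations serve as charts modelled on the locally compact space X × F.
  let _ : ChartedSpace (X × F) P :=
    { atlas := Set.range fun x => (e x).toOpenPartialHomeomorph
      chartAt := fun a => (e (proj a)).toOpenPartialHomeomorph
      mem_chart_source := fun a => (e (proj a)).mem_source.2 (he _)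
      chart_mem_atlas := fun a => ⟨proj a, rfl⟩ }
  exact ChartedSpace.locallyCompactSpace (X × F) P

theorem Bundle.Trivialization.eq_of_proj_eq_of_snd_eq (e : Trivialization F proj) {a b : P}
    (ha : proj a ∈ e.baseSet) (hab : proj a = proj b) (h : (e a).2 = (e b).2) : a = b := by
  refine e.injOn (e.mem_source.2 ha) (e.mem_source.2 (hab ▸ ha)) ?_
  change e a = e b
  rw [← e.mk_proj_snd' ha, hab, h, e.mk_proj_snd' (hab ▸ ha)]

end LocallyTrivial

/-! ### Principal bundles and associated bundles -/

namespace PrincipalBundle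

open MulOpposite (op)

/-! ### Trivializations from a free action with continuous division -/

section Division

variable {G : Type*} [Group G] [TopologicalSpace G] {X P : Type*} [TopologicalSpace X]
  [TopologicalSpace P] [MulAction Gᵐᵒᵖ P] [ContinuousSMul Gᵐᵒᵖ P] {proj : P → X}

/-- A local section of a space with a free action that is transitive on the fibers, with continuous
division map `d`, defines a local trivialization. -/
def trivializationOfSection (hproj : Continuous proj)
    (proj_smul : ∀ (g : G) (a : P), proj (op g • a) = proj a) (d : P → P → G)
    (smul_d : ∀ a b, proj a = proj b → op (d a b) • a = b)
    (d_smul : ∀ a (g : G), d a (op g • a) = g)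
    (hd : Continuous fun p : {p : P × P // proj p.1 = proj p.2} => d p.1.1 p.1.2)
    {U : Set X} (hU : IsOpen U) {σ : X → P} (hσ : ContinuousOn σ U)
    (proj_σ : ∀ x ∈ U, proj (σ x) = x) : Trivialization G proj where
  toFun a := (proj a, d (σ (proj a)) a)
  invFun p := op p.2 • σ p.1
  source := proj ⁻¹' U
  target := U ×ˢ Set.univ
  baseSet := U
  map_source' a ha := ⟨ha, trivial⟩
  map_target' p hp := by
    rw [Set.mem_preimage, proj_smul, proj_σ _ hp.1]
    exact hp.1
  left_inv' a ha := smul_d _ _ (proj_σ _ ha)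
  right_inv' p hp := by
    rw [proj_smul, proj_σ _ hp.1, d_smul]
  open_source := hU.preimage hproj
  open_target := hU.prod isOpen_univ
  open_baseSet := hU
  source_eq := rfl
  target_eq := rfl
  proj_toFun _ _ := rfl
  continuousOn_toFun := by
    refine hproj.continuousOn.prodMk ?_
    rw [continuousOn_iff_continuous_domRestrict]
    have h : Continuous fun a : proj ⁻¹' U => σ (proj a) :=
      hσ.comp_continuous (hproj.comp continuous_subtype_val) fun a => a.2
    exact hd.comp ((h.prodMk continuous_subtype_val).subtype_mk fun a => proj_σ _ a.2)
  continuousOn_invFun := by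
    refine ContinuousOn.smul (MulOpposite.continuous_op.comp continuous_snd).continuousOn ?_
    exact hσ.comp continuousOn_fst fun p hp => hp.1

end Division

variable {G : Type*} [Group G] [TopologicalSpace G] [IsTopologicalGroup G]
  {X : Type u} [TopologicalSpace X]

/-- The principal bundle defined by a free action that is transitive on the fibers of `proj`, with
continuous division map `d` and with local sections. -/
def ofDivision [T2Space X] [LocallyCompactSpace X] [T2Space G] [LocallyCompactSpace G]
    {P : Type u} [TopologicalSpace P] [MulAction Gᵐᵒᵖ P] [ContinuousSMul Gᵐᵒᵖ P] {proj : P → X}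
    (hproj : Continuous proj)
    (proj_smul : ∀ (g : G) (a : P), proj (op g • a) = proj a) (d : P → P → G)
    (smul_d : ∀ a b, proj a = proj b → op (d a b) • a = b)
    (d_smul : ∀ a (g : G), d a (op g • a) = g)
    (hd : Continuous fun p : {p : P × P // proj p.1 = proj p.2} => d p.1.1 p.1.2)
    (hσ : ∀ x, ∃ (U : Set X) (σ : X → P), IsOpen U ∧ x ∈ U ∧ ContinuousOn σ U ∧
      ∀ y ∈ U, proj (σ y) = y) : PrincipalBundle G X :=
  have ht : ∀ x, ∃ e : Trivialization G proj, x ∈ e.baseSet ∧ ∀ (g : G) (a : P),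
      proj a ∈ e.baseSet → (e (op g • a)).2 = (e a).2 * g := fun x => by
    obtain ⟨U, σ, hU, hxU, hσ, proj_σ⟩ := hσ x
    refine ⟨trivializationOfSection hproj proj_smul d smul_d d_smul hd hU hσ proj_σ, hxU,
      fun g a ha => ?_⟩
    change d (σ (proj (op g • a))) (op g • a) = d (σ (proj a)) a * g
    rw [proj_smul]
    -- Since a is σ(x) moved by d(σ(x), a), the point a · g is σ(x) moved by d(σ(x), a) · g.
    conv_lhs => rw [← smul_d _ _ (proj_σ _ ha), proj_smul, proj_σ _ ha, smul_smul,
      ← MulOpposite.op_mul, d_smul]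
  have ht' : ∀ x, ∃ e : Trivialization G proj, x ∈ e.baseSet := fun x =>
    let ⟨e, he, _⟩ := ht x
    ⟨e, he⟩
  { P := P
    lc := locallyCompactSpace_of_trivializations ht'
    t2 := t2Space_of_trivializations ht'
    proj := proj
    proj_smul := proj_smul
    locallyTrivial := ht }

theorem exists_trivialization (A : PrincipalBundle G X) (x : X) :
    ∃ e : Trivialization G A.proj, x ∈ e.baseSet :=
  let ⟨e, he, _⟩ := A.locallyTrivial x
  ⟨e, he⟩

theorem continuous_proj (A : PrincipalBundle G X) : Continuous A.proj :=
  continuous_proj_of_trivializations A.exists_trivialization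

theorem surjective_proj (A : PrincipalBundle G X) : Function.Surjective A.proj := fun x =>
  let ⟨e, he⟩ := A.exists_trivialization x
  ⟨_, e.proj_symm_apply' (x := 1) he⟩

theorem smul_right_injective (A : PrincipalBundle G X) (a : A.P) {g h : G}
    (H : op g • a = op h • a) : g = h := by
  obtain ⟨e, he, heq⟩ := A.locallyTrivial (A.proj a)
  have := heq g a he
  rw [H, heq h a he] at this
  exact (mul_left_cancel this).symm

theorem exists_smul_eq (A : PrincipalBundle G X) {a b : A.P} (hab : A.proj a = A.proj b) :
    ∃ g : G, op g • a = b := by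
  obtain ⟨e, he, heq⟩ := A.locallyTrivial (A.proj a)
  refine ⟨(e a).2⁻¹ * (e b).2, e.eq_of_proj_eq_of_snd_eq ?_ ?_ ?_⟩
  · rwa [A.proj_smul]
  · rwa [A.proj_smul]
  · rw [heq _ _ he, mul_inv_cancel_left]

/-- An equivariant continuous map over `X` is an isomorphism. -/
theorem iso_of_equivariant {A B : PrincipalBundle G X} (f : A.P → B.P) (hf : Continuous f)
    (hproj : ∀ a, B.proj (f a) = A.proj a)
    (hsmul : ∀ (g : G) (a : A.P), f (op g • a) = op g • f a) : A.Iso B := by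
  -- Points with the same image lie in one fiber, so they differ by some g, which fixes their image;
  -- freeness of the action on B gives g = 1.
  have hinj : Function.Injective f := fun a b hab => by
    obtain ⟨g, rfl⟩ := A.exists_smul_eq (a := a) (b := b) (by rw [← hproj, hab, hproj])
    rw [hsmul] at hab
    have : g = 1 := B.smul_right_injective (f a) (by rw [← hab, MulOpposite.op_one, one_smul])
    rw [this, MulOpposite.op_one, one_smul]
  have hsurj : Function.Surjective f := fun b => by
    obtain ⟨a, ha⟩ := A.surjective_proj (B.proj b)
    obtain ⟨g, hg⟩ := B.exists_smul_eq (a := f a) (b := b) (by rw [hproj, ha])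
    exact ⟨op g • a, by rw [hsmul, hg]⟩
  let F : A.P ≃ B.P := Equiv.ofBijective f ⟨hinj, hsurj⟩
  -- With a local section σ of A, the points f(σ x) and b' lie in one fiber of B and differ by a
  -- group element read off continuously in the trivialization e'; moving σ x by that element gives
  -- the preimage of b'.
  have hF : Continuous F.symm := continuous_iff_continuousAt.2 fun b => by
    obtain ⟨e, he⟩ := A.exists_trivialization (B.proj b)
    obtain ⟨e', he', heq'⟩ := B.locallyTrivial (B.proj b)
    let σ : X → A.P := fun x => e.toOpenPartialHomeomorph.symm (x, 1)
    have hσ : ∀ x ∈ e.baseSet, A.proj (σ x) = x := fun x hx => e.proj_symm_apply' hx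
    have h1 : ContinuousAt (fun b' => σ (B.proj b')) b :=
      ContinuousAt.comp (g := e.toOpenPartialHomeomorph.symm) (f := fun b' => (B.proj b', (1 : G)))
        (e.toOpenPartialHomeomorph.continuousAt_symm (e.mem_target.2 he))
        (B.continuous_proj.prodMk continuous_const).continuousAt
    have h2 : ContinuousAt (fun b' => (e' (f (σ (B.proj b')))).2) b := by
      have h3 : ContinuousAt e' (f (σ (B.proj b))) :=
        e'.toOpenPartialHomeomorph.continuousAt (e'.mem_source.2 (by rwa [hproj, hσ _ he]))
      exact (ContinuousAt.comp (f := fun b' => f (σ (B.proj b'))) h3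
        (hf.continuousAt.comp h1)).snd
    have h3 : ContinuousAt (fun b' => (e' b').2) b :=
      (e'.toOpenPartialHomeomorph.continuousAt (e'.mem_source.2 he')).snd
    have h4 : ContinuousAt (fun b' => op ((e' (f (σ (B.proj b')))).2⁻¹ * (e' b').2) •
        σ (B.proj b')) b :=
      (MulOpposite.continuous_op.continuousAt.comp (h2.inv.mul h3)).smul h1
    refine h4.congr ?_
    have h5 : ∀ᶠ b' in 𝓝 b, B.proj b' ∈ e.baseSet ∩ e'.baseSet :=
      B.continuous_proj.continuousAt.eventually
        ((e.open_baseSet.inter e'.open_baseSet).mem_nhds ⟨he, he'⟩)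
    filter_upwards [h5] with b' hb'
    rw [Equiv.eq_symm_apply]
    change f _ = b'
    have h6 : B.proj (f (σ (B.proj b'))) = B.proj b' := by rw [hproj, hσ _ hb'.1]
    refine e'.eq_of_proj_eq_of_snd_eq ?_ ?_ ?_
    · rw [hsmul, B.proj_smul, h6]
      exact hb'.2
    · rw [hsmul, B.proj_smul, h6]
    · rw [hsmul, heq' _ _ (by rw [h6]; exact hb'.2), mul_inv_cancel_left]
  exact ⟨⟨F, hf, hF⟩, hproj, hsmul⟩

/-! ### Associated bundles and their local triviality -/

section Assoc

variable (A : PrincipalBundle G X) {F : Type*} [MulAction G F]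

theorem Assoc.mk_smul (a : A.P) (g : G) (t : F) :
    Assoc.mk A (op g • a) t = Assoc.mk A a (g • t) :=
  (Quot.sound ⟨g, by simp⟩).symm

/-- The relation being divided out is an orbit relation, hence already an equivalence relation. -/
theorem Assoc.exists_of_mk_eq {a b : A.P} {t s : F} (h : Assoc.mk A a t = Assoc.mk A b s) :
    ∃ g : G, b = op g • a ∧ t = g • s := by
  have he : Equivalence fun p q : A.P × F => ∃ g : G, q = (op g • p.1, g⁻¹ • p.2) :=
    { refl := fun p => ⟨1, by simp⟩
      symm := by
        rintro p q ⟨g, rfl⟩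
        exact ⟨g⁻¹, by simp [smul_smul]⟩
      trans := by
        rintro p q r ⟨g, rfl⟩ ⟨h, rfl⟩
        exact ⟨g * h, by simp [smul_smul]⟩ }
  obtain ⟨g, hg⟩ := (he.quot_mk_eq_iff _ _).1 h
  refine ⟨g, congrArg Prod.fst hg, ?_⟩
  have := congrArg Prod.snd hg
  dsimp only at this
  rw [this, smul_inv_smul]

theorem Assoc.mk_surjective (q : A.Assoc F) : ∃ a t, Assoc.mk A a t = q := by
  obtain ⟨⟨a, t⟩, h⟩ := Quot.exists_rep q
  exact ⟨a, t, h⟩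

variable (F) in
/-- The projection `P ×_G F → X`. -/
def Assoc.proj : A.Assoc F → X :=
  Quot.lift (fun p => A.proj p.1) (by rintro p q ⟨g, rfl⟩; exact (A.proj_smul g _).symm)

theorem Assoc.proj_mk (a : A.P) (t : F) : Assoc.proj A F (Assoc.mk A a t) = A.proj a := rfl

/-- A class in `P ×_G F` is represented over every given point of `P` in the fiber. -/
theorem Assoc.exists_rep_of_proj_eq {q : A.Assoc F} {a : A.P} (h : Assoc.proj A F q = A.proj a) :
    ∃ t, Assoc.mk A a t = q := by
  obtain ⟨b, t, rfl⟩ := Assoc.mk_surjective A q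
  obtain ⟨g, rfl⟩ := A.exists_smul_eq (a := a) (b := b) h.symm
  exact ⟨g • t, (Assoc.mk_smul A a g t).symm⟩

variable [TopologicalSpace F] [ContinuousSMul G F]

variable (F) in
-- The saturation of an open set is the union of its preimages under the group translations.
-- Openness allows continuity on the quotient to be tested at a single point.
theorem Assoc.isOpenQuotientMap_mk :
    IsOpenQuotientMap fun p : A.P × F => Assoc.mk A p.1 p.2 where
  surjective q := by
    obtain ⟨a, t, h⟩ := Assoc.mk_surjective A q
    exact ⟨(a, t), h⟩
  continuous := continuous_quot_mk
  isOpenMap V hV := by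
    have hq : IsQuotientMap fun p : A.P × F => Assoc.mk A p.1 p.2 := isQuotientMap_quot_mk
    refine hq.isOpen_preimage.1 ?_
    have h : (fun p : A.P × F => Assoc.mk A p.1 p.2) ⁻¹'
        ((fun p : A.P × F => Assoc.mk A p.1 p.2) '' V) =
        ⋃ g : G, (fun p : A.P × F => (op g • p.1, g⁻¹ • p.2)) ⁻¹' V := by
      ext ⟨a, t⟩
      simp only [Set.mem_preimage, Set.mem_image, Set.mem_iUnion, Prod.exists]
      constructor
      · rintro ⟨b, s, hV, hbs⟩
        obtain ⟨g, rfl, ht⟩ := Assoc.exists_of_mk_eq A (a := a) (t := t) (b := b) (s := s) hbs.symm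
        refine ⟨g, ?_⟩
        rwa [ht, inv_smul_smul]
      · rintro ⟨g, hg⟩
        refine ⟨_, _, hg, ?_⟩
        rw [Assoc.mk_smul, smul_inv_smul]
    rw [h]
    exact isOpen_iUnion fun g => hV.preimage (by fun_prop)

theorem Assoc.continuous_mk : Continuous fun p : A.P × F => Assoc.mk A p.1 p.2 :=
  (Assoc.isOpenQuotientMap_mk A F).continuous

variable (F) in
theorem Assoc.continuous_proj : Continuous (Assoc.proj A F) :=
  (Assoc.isOpenQuotientMap_mk A F).isQuotientMap.continuous_iff.2
    (A.continuous_proj.comp continuous_fst)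

variable (F) in
-- Equivariance of e makes e(a) • t independent of the representative (a, t); the inverse map uses
-- the local section of P that e sends to 1.
theorem Assoc.exists_trivialization (e : Trivialization G A.proj)
    (he : ∀ (g : G) (a : A.P), A.proj a ∈ e.baseSet → (e (op g • a)).2 = (e a).2 * g) :
    ∃ e' : Trivialization F (Assoc.proj A F), e'.baseSet = e.baseSet ∧
      (∀ a t, A.proj a ∈ e.baseSet → e' (Assoc.mk A a t) = (A.proj a, (e a).2 • t)) ∧
      ∀ x t, e'.toOpenPartialHomeomorph.symm (x, t) =
        Assoc.mk A (e.toOpenPartialHomeomorph.symm (x, 1)) t := by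
  let f : A.Assoc F → X × F := fun q => (Assoc.proj A F q, (e q.out.1).2 • q.out.2)
  have hf : ∀ a t, A.proj a ∈ e.baseSet → f (Assoc.mk A a t) = (A.proj a, (e a).2 • t) :=
    fun a t ha => by
      refine Prod.ext rfl ?_
      obtain ⟨g, hg, ht⟩ := Assoc.exists_of_mk_eq A (a := a) (t := t)
        (b := (Assoc.mk A a t).out.1) (s := (Assoc.mk A a t).out.2) (Quot.out_eq _).symm
      change (e (Assoc.mk A a t).out.1).2 • (Assoc.mk A a t).out.2 = (e a).2 • t
      rw [hg, he _ _ ha, mul_smul, ← ht]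
  have hσ : ∀ x ∈ e.baseSet, A.proj (e.toOpenPartialHomeomorph.symm (x, 1)) = x :=
    fun x hx => e.proj_symm_apply' hx
  refine ⟨
    { toFun := f
      invFun := fun p => Assoc.mk A (e.toOpenPartialHomeomorph.symm (p.1, 1)) p.2
      source := Assoc.proj A F ⁻¹' e.baseSet
      target := e.baseSet ×ˢ Set.univ
      baseSet := e.baseSet
      map_source' := fun q hq => ⟨hq, trivial⟩
      map_target' := fun p hp => by
        rw [Set.mem_preimage, Assoc.proj_mk, hσ _ hp.1]
        exact hp.1
      left_inv' := fun q hq => ?_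
      right_inv' := fun p hp => ?_
      open_source := e.open_baseSet.preimage (Assoc.continuous_proj A F)
      open_target := e.open_baseSet.prod isOpen_univ
      open_baseSet := e.open_baseSet
      source_eq := rfl
      target_eq := rfl
      proj_toFun := fun _ _ => rfl
      continuousOn_toFun := fun q hq => ContinuousAt.continuousWithinAt ?_
      continuousOn_invFun := ?_ }, rfl, hf, fun _ _ => rfl⟩
  · obtain ⟨x, hx, t, rfl⟩ : ∃ x ∈ e.baseSet, ∃ t,
        Assoc.mk A (e.toOpenPartialHomeomorph.symm (x, 1)) t = q :=
      ⟨_, hq, Assoc.exists_rep_of_proj_eq A (hσ _ hq).symm⟩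
    rw [hf _ _ (by rwa [hσ x hx]), hσ x hx, e.apply_symm_apply' hx, one_smul]
  · have := hσ _ hp.1
    rw [hf _ _ (by rw [this]; exact hp.1), this, e.apply_symm_apply' hp.1, one_smul]
  · obtain ⟨a, t, rfl⟩ := Assoc.mk_surjective A q
    -- The value of f is computed from an arbitrary representative, but near q it agrees with the
    -- continuous formula `hf` in terms of (a, t).
    refine ((Assoc.isOpenQuotientMap_mk A F).continuousAt_comp_iff (x := (a, t))).1 ?_
    have h1 : ContinuousAt (fun p : A.P × F => (A.proj p.1, (e p.1).2 • p.2)) (a, t) :=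
      (A.continuous_proj.comp continuous_fst).continuousAt.prodMk
        (ContinuousAt.smul (ContinuousAt.snd (ContinuousAt.comp (f := Prod.fst)
          (e.toOpenPartialHomeomorph.continuousAt (e.mem_source.2 hq)) continuousAt_fst))
          continuousAt_snd)
    refine h1.congr ?_
    filter_upwards [(e.open_baseSet.preimage (A.continuous_proj.comp continuous_fst)).mem_nhds hq]
      with p hp
    exact (hf _ _ hp).symm
  · refine (Assoc.continuous_mk A).comp_continuousOn (ContinuousOn.prodMk ?_ continuousOn_snd)
    exact e.continuousOn_symm_prodMk_left.comp continuousOn_fst fun p hp => hp.1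

end Assoc

end PrincipalBundle

/-! ### Hermitian line bundles -/

namespace HermitianLineBundle

variable {Z : Type u} [TopologicalSpace Z] (L : HermitianLineBundle Z)

/-- The total space of a Hermitian line bundle. -/
abbrev Tot : Type u := TotalSpace ℂ L.E

theorem exists_trivialization (z : Z) :
    ∃ e : Trivialization ℂ (TotalSpace.proj : L.Tot → Z), z ∈ e.baseSet :=
  ⟨trivializationAt ℂ L.E z, FiberBundle.mem_baseSet_trivializationAt' z⟩

theorem t2Space_tot [T2Space Z] : T2Space L.Tot :=
  t2Space_of_trivializations L.exists_trivialization

theorem continuous_smul :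
    Continuous fun p : ℂ × L.Tot => (⟨p.2.proj, p.1 • p.2.2⟩ : L.Tot) := by
  refine continuous_iff_continuousAt.2 fun p => ?_
  have hp : Continuous fun p : ℂ × L.Tot => p.2.proj :=
    (FiberBundle.continuous_proj ℂ L.E).comp continuous_snd
  refine (FiberBundle.continuousAt_totalSpace ℂ _).2 ⟨hp.continuousAt, ?_⟩
  set e := trivializationAt ℂ L.E p.2.proj with he
  have hpe : p.2.proj ∈ e.baseSet := FiberBundle.mem_baseSet_trivializationAt' _
  have h1 : ContinuousAt (fun q : ℂ × L.Tot => q.1 * (e q.2).2) p :=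
    continuousAt_fst.mul (ContinuousAt.snd (ContinuousAt.comp (f := Prod.snd)
      (e.toOpenPartialHomeomorph.continuousAt (e.mem_source.2 hpe)) continuousAt_snd))
  refine h1.congr ?_
  filter_upwards [(e.open_baseSet.preimage hp).mem_nhds hpe] with q hq
  exact ((e.linear ℂ hq).map_smul q.1 q.2.2).symm

theorem exists_eq_smul {z : Z} {v : L.E z} (hv : v ≠ 0) (w : L.E z) : ∃ c : ℂ, w = c • v := by
  let e := (trivializationAt ℂ L.E z).linearEquivAt ℂ z
    (FiberBundle.mem_baseSet_trivializationAt' z)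
  have hev : e v ≠ 0 := e.map_ne_zero_iff.2 hv
  refine ⟨e w / e v, e.injective ?_⟩
  rw [map_smul, smul_eq_mul, div_mul_cancel₀ _ hev]

theorem metric_self {z : Z} (v : L.E z) : L.metric z v v = ((L.metric z v v).re : ℂ) :=
  (Complex.conj_eq_iff_re.1 (L.metric_symm z v v)).symm

theorem ne_zero_of_metric_self_eq_one {z : Z} {v : L.E z} (hv : L.metric z v v = 1) : v ≠ 0 := by
  rintro rfl
  simp at hv

theorem metric_smul_smul {z : Z} (c d : ℂ) (v w : L.E z) :
    L.metric z (c • v) (d • w) = conj c * d * L.metric z v w := by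
  simp only [map_smulₛₗ, LinearMap.smul_apply, smul_eq_mul, RingHom.id_apply]
  ring

/-- A fiber is spanned by any of its unit vectors. -/
theorem metric_smul_eq {z : Z} {u : L.E z} (hu : L.metric z u u = 1) (v : L.E z) :
    L.metric z u v • u = v := by
  obtain ⟨c, rfl⟩ := L.exists_eq_smul (L.ne_zero_of_metric_self_eq_one hu) v
  simp [hu]

/-- Since v = ⟨u, v⟩ u, unit vectors of a line differ by a phase. These phases are the torus
coordinates of the structure group. -/
theorem norm_metric_eq_one {z : Z} {u v : L.E z} (hu : L.metric z u u = 1)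
    (hv : L.metric z v v = 1) : ‖L.metric z u v‖ = 1 := by
  have h := hv
  rw [← L.metric_smul_eq hu v, metric_smul_smul, hu, mul_one, ← Complex.normSq_eq_conj_mul_self,
    Complex.normSq_eq_norm_sq] at h
  exact (pow_eq_one_iff_of_nonneg (norm_nonneg _) two_ne_zero).1 (by exact_mod_cast h)

/-- The topology of E ⊕ E is induced from the product of the two total spaces, so both vectors may
vary separately. -/
theorem continuous_metric {Y : Type*} [TopologicalSpace Y] {f : Y → Z} {v w : ∀ y, L.E (f y)}
    (hv : Continuous fun y => (⟨f y, v y⟩ : L.Tot))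
    (hw : Continuous fun y => (⟨f y, w y⟩ : L.Tot)) :
    Continuous fun y => L.metric (f y) (v y) (w y) := by
  have h : Continuous fun y => (⟨f y, (v y, w y)⟩ : TotalSpace (ℂ × ℂ) (L.E ×ᵇ L.E)) :=
    (FiberBundle.Prod.isInducing_diag ℂ L.E ℂ L.E).continuous_iff.2 (hv.prodMk hw)
  exact L.metric_continuous.comp h

/-- The inner product of two vectors of the same fiber (and `0` if the fibers are different). -/
noncomputable def inner (v w : L.Tot) : ℂ := by
  classical
  exact if h : w.proj = v.proj then L.metric v.proj v.2 (h ▸ w.2) else 0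

theorem inner_mk (z : Z) (v w : L.E z) : L.inner ⟨z, v⟩ ⟨z, w⟩ = L.metric z v w := dif_pos rfl

/-- Because of `h`, the default value 0 never occurs. -/
theorem continuous_inner {Y : Type*} [TopologicalSpace Y] {v w : Y → L.Tot} (hv : Continuous v)
    (hw : Continuous w) (h : ∀ y, (w y).proj = (v y).proj) :
    Continuous fun y => L.inner (v y) (w y) := by
  have h' : ∀ y, ∃ w' : L.E (v y).proj, w y = ⟨(v y).proj, w'⟩ := fun y => by
    rw [← h]
    exact ⟨_, rfl⟩
  choose w' hw' using h'
  refine (L.continuous_metric (f := fun y => (v y).proj) (v := fun y => (v y).2) (w := w') hv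
    (hw.congr hw')).congr fun y => ?_
  rw [hw', ← inner_mk]

/-- The vector `v / ‖v‖`. -/
noncomputable def normalize (v : L.Tot) : L.Tot :=
  ⟨v.proj, (((√(L.metric v.proj v.2 v.2).re)⁻¹ : ℝ) : ℂ) • v.2⟩

theorem continuous_normalize {Y : Type*} [TopologicalSpace Y] {v : Y → L.Tot} (hv : Continuous v)
    (h : ∀ y, (v y).2 ≠ 0) : Continuous fun y => L.normalize (v y) := by
  have h1 : Continuous fun y => L.metric (v y).proj (v y).2 (v y).2 := L.continuous_metric hv hv
  refine L.continuous_smul.comp (Continuous.prodMk (Complex.continuous_ofReal.comp ?_) hv)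
  refine (Real.continuous_sqrt.comp (Complex.continuous_re.comp h1)).inv₀ fun y => ?_
  exact (Real.sqrt_pos.2 (L.metric_pos _ _ (h y))).ne'

theorem metric_normalize {v : L.Tot} (h : v.2 ≠ 0) :
    L.metric _ (L.normalize v).2 (L.normalize v).2 = 1 := by
  have h1 := L.metric_pos _ _ h
  change L.metric v.proj ((((√(L.metric v.proj v.2 v.2).re)⁻¹ : ℝ) : ℂ) • v.2)
    ((((√(L.metric v.proj v.2 v.2).re)⁻¹ : ℝ) : ℂ) • v.2) = 1
  rw [metric_smul_smul, L.metric_self v.2, Complex.conj_ofReal]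
  norm_cast
  rw [← mul_inv, Real.mul_self_sqrt h1.le, inv_mul_cancel₀ h1.ne']

/-- Phases preserve length. This makes the map of frames in `Iso.frameBundle_iso` equivariant. -/
theorem normalize_circle_smul (z : Z) (c : Circle) (v : L.E z) :
    L.normalize ⟨z, (c : ℂ) • v⟩ = ⟨z, (c : ℂ) • (L.normalize ⟨z, v⟩).2⟩ := by
  have h : L.metric z ((c : ℂ) • v) ((c : ℂ) • v) = L.metric z v v := by
    rw [metric_smul_smul, ← Complex.normSq_eq_conj_mul_self, Circle.normSq_coe,
      Complex.ofReal_one, one_mul]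
  simp only [normalize, h]
  exact congrArg (TotalSpace.mk z) (smul_comm _ _ _)

/-- The section with constant coordinate 1 in a trivialization vanishes nowhere and can be
normalized. -/
theorem exists_local_unit_section (z : Z) : ∃ (U : Set Z) (u : ∀ z, L.E z), IsOpen U ∧ z ∈ U ∧
    (ContinuousOn (fun z => (⟨z, u z⟩ : L.Tot)) U) ∧ ∀ z ∈ U, L.metric z (u z) (u z) = 1 := by
  set e := trivializationAt ℂ L.E z
  let s : Z → L.Tot := fun y => ⟨y, e.symm y 1⟩
  have hs : ContinuousOn s e.baseSet :=
    e.continuousOn_symm.comp (f := fun y => (y, (1 : ℂ))) (by fun_prop)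
      fun y hy => ⟨hy, trivial⟩
  have hs0 : ∀ y ∈ e.baseSet, (s y).2 ≠ 0 := fun y hy h0 => by
    have h := e.apply_mk_symm hy (1 : ℂ)
    have h' : e.symm y (1 : ℂ) = 0 := h0
    rw [h'] at h
    have h2 := (e.linear ℂ hy).map_zero
    rw [h] at h2
    exact one_ne_zero h2
  refine ⟨e.baseSet, fun y => (L.normalize (s y)).2, e.open_baseSet,
    FiberBundle.mem_baseSet_trivializationAt' z, ?_, fun y hy => L.metric_normalize (hs0 y hy)⟩
  rw [continuousOn_iff_continuous_domRestrict] at hs ⊢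
  exact L.continuous_normalize hs fun y => hs0 y y.2

/-- A line bundle is trivial if and only if it has a continuous unit section. -/
theorem isomorphic_trivial_iff : LineBundleIsomorphic L.E (Bundle.Trivial Z ℂ) ↔
    ∃ u : ∀ z, L.E z, (Continuous fun z => (⟨z, u z⟩ : L.Tot)) ∧
      ∀ z, L.metric z (u z) (u z) = 1 := by
  constructor
  · rintro ⟨ℓ, -, h⟩
    let s : Z → L.Tot := fun z => ⟨z, (ℓ z).symm (1 : ℂ)⟩
    have hs : Continuous s := by
      have h1 : Continuous fun z : Z => (⟨z, (1 : ℂ)⟩ : TotalSpace ℂ (Bundle.Trivial Z ℂ)) :=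
        (Bundle.Trivial.homeomorphProd Z ℂ).symm.continuous.comp
          (continuous_id.prodMk continuous_const)
      exact h.comp h1
    have hs0 : ∀ z, (s z).2 ≠ 0 := fun z =>
      (ℓ z).symm.map_ne_zero_iff.2 (one_ne_zero (α := ℂ))
    exact ⟨fun z => (L.normalize (s z)).2, L.continuous_normalize hs hs0,
      fun z => L.metric_normalize (hs0 z)⟩
  · rintro ⟨u, hu, hu1⟩
    -- For a unit vector u of a line, v ↦ ⟨u, v⟩ and c ↦ c u are mutually inverse.
    let ℓ : ∀ z, L.E z ≃ₗ[ℂ] Bundle.Trivial Z ℂ z := fun z =>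
      LinearEquiv.ofLinearMap (M₂ := ℂ) (L.metric z (u z)) (LinearMap.toSpanSingleton ℂ _ (u z))
        (by ext; simp [hu1]) (by ext v; simp [L.metric_smul_eq (hu1 z)])
    refine ⟨ℓ, ?_, ?_⟩
    · have h1 : Continuous fun v : L.Tot => (v.proj, L.metric v.proj (u v.proj) v.2) :=
        (FiberBundle.continuous_proj ℂ L.E).prodMk (L.continuous_metric
          (hu.comp (FiberBundle.continuous_proj ℂ L.E)) continuous_id)
      exact (Bundle.Trivial.homeomorphProd Z ℂ).symm.continuous.comp h1
    · have h1 : Continuous fun v : TotalSpace ℂ (Bundle.Trivial Z ℂ) => (v.proj, (v.2 : ℂ)) :=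
        (Bundle.Trivial.homeomorphProd Z ℂ).continuous
      exact L.continuous_smul.comp
        ((continuous_snd.comp h1).prodMk (hu.comp (continuous_fst.comp h1)))

end HermitianLineBundle

/-! ### Locally constant indices and local sections -/

/-- With finitely many values every preimage is a finite union of closed sets. In the applications
the fibers are equalizers of continuous maps into a Hausdorff space. -/
theorem isLocallyConstant_of_isClosed_fibers {Y α : Type*} [TopologicalSpace Y] [Finite α]
    {f : Y → α} (h : ∀ a, IsClosed {y | f y = a}) : IsLocallyConstant f := by
  let _ : TopologicalSpace α := ⊥
  have : DiscreteTopology α := ⟨rfl⟩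
  refine (IsLocallyConstant.iff_continuous f).2 (continuous_iff_isClosed.2 fun s _ => ?_)
  have hs : f ⁻¹' s = ⋃ a ∈ s, {y | f y = a} := by
    ext y
    simp
  rw [hs]
  exact s.toFinite.isClosed_biUnion fun a _ => h a

theorem IsLocallyConstant.continuous_eval {Y α W : Type*} [TopologicalSpace Y]
    [TopologicalSpace W] {f : Y → α → W} {a : Y → α} (ha : IsLocallyConstant a)
    (hf : ∀ b, Continuous fun y => f y b) : Continuous fun y => f y (a y) := by
  refine continuous_iff_continuousAt.2 fun y => (hf (a y)).continuousAt.congr ?_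
  filter_upwards [(IsLocallyConstant.iff_eventually_eq a).1 ha y] with x hx
  rw [hx]

/-- Values outside U are irrelevant; the point x only supplies one. -/
theorem exists_continuousOn_extend {X P : Type*} [TopologicalSpace X] [TopologicalSpace P]
    {U : Set X} {x : X} (hx : x ∈ U) {σ : U → P} (hσ : Continuous σ) :
    ∃ σ' : X → P, ContinuousOn σ' U ∧ ∀ y : U, σ' y = σ y := by
  classical
  let σ' : X → P := fun y => if h : y ∈ U then σ ⟨y, h⟩ else σ ⟨x, hx⟩
  have h : ∀ y : U, σ' y = σ y := fun y => dif_pos y.2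
  exact ⟨σ', continuousOn_iff_continuous_domRestrict.2 (hσ.congr fun y => (h y).symm), h⟩

namespace HermitianLineBundle

variable {Z : Type u} [TopologicalSpace Z] (L : HermitianLineBundle Z)

theorem inner_smul_eq {u v : L.Tot} (hu : L.metric _ u.2 u.2 = 1) (h : v.proj = u.proj) :
    (⟨u.proj, L.inner u v • u.2⟩ : L.Tot) = v := by
  obtain ⟨z, u⟩ := u
  obtain ⟨w, v⟩ := v
  obtain rfl : w = z := h
  rw [inner_mk]
  exact congrArg (TotalSpace.mk w) (L.metric_smul_eq hu v)

theorem norm_inner_eq_one {u v : L.Tot} (hu : L.metric _ u.2 u.2 = 1)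
    (hv : L.metric _ v.2 v.2 = 1) (h : v.proj = u.proj) : ‖L.inner u v‖ = 1 := by
  obtain ⟨z, u⟩ := u
  obtain ⟨w, v⟩ := v
  obtain rfl : w = z := h
  rw [inner_mk]
  exact L.norm_metric_eq_one hu hv

theorem inner_smul_self {u : L.Tot} (hu : L.metric _ u.2 u.2 = 1) (c : ℂ) :
    L.inner u ⟨u.proj, c • u.2⟩ = c := by
  change L.inner ⟨u.proj, u.2⟩ ⟨u.proj, c • u.2⟩ = c
  rw [inner_mk, map_smul, hu, smul_eq_mul, mul_one]

theorem metric_circle_smul {z : Z} {u : L.E z} (hu : L.metric z u u = 1) (c : Circle) :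
    L.metric z ((c : ℂ) • u) ((c : ℂ) • u) = 1 := by
  rw [metric_smul_smul, ← Complex.normSq_eq_conj_mul_self, Circle.normSq_coe,
      Complex.ofReal_one, one_mul, hu]

end HermitianLineBundle

/-! ### The frame bundle of a twisted covering -/

namespace TwistedCovering

open MulOpposite (op unop)
open PrincipalBundle (Assoc)

variable {n : ℕ} {X : Type u} [TopologicalSpace X]

/-- A frame of a twisted covering over a point of `X`: an enumeration of the fiber of the covering,
with a unit vector in the line over each point of the fiber. -/
def Frame (T : TwistedCovering n X) : Type u :=
  {f : Fin n → T.L.Tot // (∀ i, T.L.metric _ (f i).2 (f i).2 = 1) ∧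
    (Function.Injective fun i => (f i).proj) ∧ ∀ i j, T.s (f i).proj = T.s (f j).proj}

namespace Frame

variable {T : TwistedCovering n X}

instance : TopologicalSpace T.Frame := inferInstanceAs (TopologicalSpace (Subtype _))

instance : CoeFun T.Frame fun _ => Fin n → T.L.Tot := ⟨Subtype.val⟩

theorem ext {f f' : T.Frame} (h : ∀ i, f i = f' i) : f = f' := Subtype.ext (funext h)

theorem continuous_apply (i : Fin n) : Continuous fun f : T.Frame => f i :=
  (_root_.continuous_apply i).comp continuous_subtype_val

theorem continuous_base (i : Fin n) : Continuous fun f : T.Frame => (f i).proj :=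
  (FiberBundle.continuous_proj ℂ T.L.E).comp (continuous_apply i)

theorem continuous_of {Y : Type*} [TopologicalSpace Y] {f : Y → T.Frame}
    (h : ∀ i, Continuous fun y => f y i) : Continuous f :=
  continuous_induced_rng.2 (continuous_pi h)

theorem unit (f : T.Frame) (i : Fin n) : T.L.metric _ (f i).2 (f i).2 = 1 := f.2.1 i

theorem injective (f : T.Frame) : Function.Injective fun i => (f i).proj := f.2.2.1

/-- The formula is forced by the requirement that [f · g, (i, 1)] and [f, g • (i, 1)] evaluate to
the same vector. -/
noncomputable instance : MulAction (TorusPerm n)ᵐᵒᵖ T.Frame where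
  smul g f := ⟨fun i => ⟨(f (g.unop.right i)).proj,
    (g.unop.left (g.unop.right i) : ℂ) • (f (g.unop.right i)).2⟩,
    fun i => T.L.metric_circle_smul (f.unit _) _,
    f.injective.comp g.unop.right.injective, fun i j => f.2.2.2 _ _⟩
  one_smul f := ext fun i => congrArg (TotalSpace.mk (f i).proj) (one_smul ℂ (f i).2)
  mul_smul g h f := ext fun i => by
    refine congrArg (TotalSpace.mk (f (h.unop.right (g.unop.right i))).proj) ?_
    change _ = (g.unop.left (g.unop.right i) : ℂ) •
      ((h.unop.left (h.unop.right (g.unop.right i)) : ℂ) • (f (h.unop.right (g.unop.right i))).2)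
    rw [smul_smul, mul_comm]
    refine congrArg (· • (f (h.unop.right (g.unop.right i))).2) ?_
    change ((h.unop.left _ * g.unop.left (h.unop.right⁻¹ (h.unop.right (g.unop.right i))) :
      Circle) : ℂ) = _
    rw [Circle.coe_mul]
    simp

theorem smul_apply (g : TorusPerm n) (f : T.Frame) (i : Fin n) :
    (op g • f) i = ⟨(f (g.right i)).proj, (g.left (g.right i) : ℂ) • (f (g.right i)).2⟩ := rfl

theorem smul_base (g : TorusPerm n) (f : T.Frame) (i : Fin n) :
    ((op g • f) i).proj = (f (g.right i)).proj := rfl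

instance : ContinuousSMul (TorusPerm n)ᵐᵒᵖ T.Frame where
  continuous_smul := by
    refine continuous_of fun i => ?_
    have hu : Continuous fun p : (TorusPerm n)ᵐᵒᵖ × T.Frame => p.1.unop :=
      MulOpposite.continuous_unop.comp continuous_fst
    have h : IsLocallyConstant fun p : (TorusPerm n)ᵐᵒᵖ × T.Frame => p.1.unop.right i :=
      ((TorusPerm.isLocallyConstant_right n).comp_continuous hu).comp fun σ => σ i
    refine T.L.continuous_smul.comp (Continuous.prodMk (continuous_circle_coe.comp ?_) ?_)
    · exact h.continuous_eval (f := fun p j => p.1.unop.left j) fun j =>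
        (_root_.continuous_apply j).comp ((TorusPerm.continuous_left n).comp hu)
    · exact h.continuous_eval (f := fun p j => p.2 j) fun j =>
        (continuous_apply j).comp continuous_snd

/-- The base points of the moved frame determine the permutation, and inner products with the
vectors of f recover the phases. -/
theorem smul_right_injective (f : T.Frame) {g h : TorusPerm n} (H : op g • f = op h • f) :
    g = h := by
  have H' : ∀ i, (op g • f) i = (op h • f) i := fun i => by rw [H]
  have hr : g.right = h.right := Equiv.ext fun i =>
    f.injective (by
      have := congrArg TotalSpace.proj (H' i)
      rwa [smul_base, smul_base] at this)
  refine SemidirectProduct.ext (funext fun j => ?_) hr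
  obtain ⟨i, rfl⟩ := g.right.surjective j
  have := H' i
  rw [smul_apply, smul_apply, ← hr] at this
  have h2 := congrArg (T.L.inner (f (g.right i))) this
  rw [T.L.inner_smul_self (f.unit _), T.L.inner_smul_self (f.unit _)] at h2
  exact Circle.ext h2

/-- The n distinct base points of a frame exhaust a fiber with n points. -/
theorem exists_index {z : T.Z} {f : T.Frame} {i : Fin n} (h : T.s z = T.s (f i).proj) :
    ∃ j, (f j).proj = z := by
  have hsub : Set.range (fun j => (f j).proj) ⊆ T.s ⁻¹' {T.s z} := by
    rintro _ ⟨j, rfl⟩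
    exact (f.2.2.2 j i).trans h.symm
  have hfin : (T.s ⁻¹' {T.s z}).Finite :=
    Set.finite_of_encard_eq_coe (T.sheets (T.s z))
  have hcard : (Set.range fun j => (f j).proj).encard = n := by
    rw [← Set.image_univ, f.injective.encard_image]
    simp
  have := hfin.eq_of_subset_of_encard_le' hsub (by rw [hcard, T.sheets])
  exact this.symm.subset (Set.mem_singleton _)

variable [NeZero n]

/-- The base point of a frame. -/
def proj (f : T.Frame) : X := T.s (f 0).proj

theorem s_base (f : T.Frame) (i : Fin n) : T.s (f i).proj = f.proj := f.2.2.2 i 0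

theorem continuous_proj : Continuous (proj : T.Frame → X) :=
  T.isCoveringMap.continuous.comp (continuous_base 0)

theorem proj_smul (g : TorusPerm n) (f : T.Frame) : (op g • f).proj = f.proj :=
  f.s_base (g.right 0)

/-- The permutation matches the base points of the two frames, and the phases are the inner products
of matching unit vectors. -/
theorem exists_smul_eq {f f' : T.Frame} (h : f.proj = f'.proj) :
    ∃ g : TorusPerm n, op g • f = f' := by
  have h1 : ∀ i, ∃ j, (f j).proj = (f' i).proj := fun i =>
    exists_index (i := 0) ((s_base f' i).trans h.symm)
  choose σ hσ using h1
  have hinj : Function.Injective σ := fun i j hij =>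
    f'.injective (show (f' i).proj = (f' j).proj by rw [← hσ, ← hσ, hij])
  let τ : Equiv.Perm (Fin n) := Equiv.ofBijective σ (Finite.injective_iff_bijective.1 hinj)
  have hτ : ∀ j, (f' (τ.symm j)).proj = (f j).proj := fun j => by
    rw [← hσ]
    exact congrArg (fun j => (f j).proj) (τ.apply_symm_apply j)
  refine ⟨⟨fun j => ⟨T.L.inner (f j) (f' (τ.symm j)), mem_sphere_zero_iff_norm.2
    (T.L.norm_inner_eq_one (f.unit _) (f'.unit _) (hτ j))⟩, τ⟩, ext fun i => ?_⟩
  rw [smul_apply]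
  change (⟨(f (τ i)).proj, T.L.inner (f (τ i)) (f' (τ.symm (τ i))) • (f (τ i)).2⟩ : T.L.Tot) = f' i
  rw [τ.symm_apply_apply]
  exact T.L.inner_smul_eq (f.unit _) (hσ i).symm

open Classical in
/-- The element of `𝕋ⁿ ⋊ Sₙ` which carries a frame to another frame over the same point. -/
noncomputable def div (f f' : T.Frame) : TorusPerm n :=
  if h : f.proj = f'.proj then (exists_smul_eq h).choose else 1

theorem smul_div {f f' : T.Frame} (h : f.proj = f'.proj) : op (div f f') • f = f' := by
  rw [div, dif_pos h]
  exact (exists_smul_eq h).choose_spec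

theorem div_smul (f : T.Frame) (g : TorusPerm n) : div f (op g • f) = g :=
  f.smul_right_injective (smul_div (proj_smul g f).symm)

theorem continuous_div :
    Continuous fun p : {p : T.Frame × T.Frame // p.1.proj = p.2.proj} => div p.1.1 p.1.2 := by
  set d : {p : T.Frame × T.Frame // p.1.proj = p.2.proj} → TorusPerm n :=
    fun p => div p.1.1 p.1.2
  have hd : ∀ (p : {p : T.Frame × T.Frame // p.1.proj = p.2.proj}) i,
      p.1.2 i = ⟨(p.1.1 ((d p).right i)).proj,
      ((d p).left ((d p).right i) : ℂ) • (p.1.1 ((d p).right i)).2⟩ := fun p i => by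
    rw [← smul_apply, smul_div p.2]
  have hfst : ∀ i, Continuous fun p : {p : T.Frame × T.Frame // p.1.proj = p.2.proj} => p.1.1 i :=
    fun i => (continuous_apply i).comp (continuous_fst.comp continuous_subtype_val)
  have hsnd : ∀ i, Continuous fun p : {p : T.Frame × T.Frame // p.1.proj = p.2.proj} => p.1.2 i :=
    fun i => (continuous_apply i).comp (continuous_snd.comp continuous_subtype_val)
  have hπ := FiberBundle.continuous_proj ℂ T.L.E
  -- The permutation equals τ exactly where certain base points agree, which is a closed condition
  -- in the Hausdorff space Z.
  have hr : IsLocallyConstant fun p => (d p).right := by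
    refine isLocallyConstant_of_isClosed_fibers fun τ => ?_
    have : {p | (d p).right = τ} = ⋂ i, {p | (p.1.2 i).proj = (p.1.1 (τ i)).proj} := by
      ext p
      simp only [Set.mem_ofPred_eq, Set.mem_iInter]
      refine ⟨fun h i => by rw [hd, h], fun h => Equiv.ext fun i => p.1.1.injective ?_⟩
      exact (congrArg TotalSpace.proj (hd p i)).symm.trans (h i)
    rw [this]
    exact isClosed_iInter fun i => isClosed_eq (hπ.comp (hsnd i)) (hπ.comp (hfst _))
  -- The j-th phase is the inner product of f(j) with f'(σ⁻¹ j), where the index σ⁻¹ j is locally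
  -- constant.
  refine TorusPerm.continuous_of (continuous_pi fun j => continuous_induced_rng.2 ?_) hr
  have h1 : Continuous fun p : {p : T.Frame × T.Frame // p.1.proj = p.2.proj} =>
      p.1.2 ((d p).right⁻¹ j) :=
    (hr.comp fun τ => τ⁻¹ j).continuous_eval hsnd
  have h2 : ∀ p : {p : T.Frame × T.Frame // p.1.proj = p.2.proj}, p.1.2 ((d p).right⁻¹ j) =
      ⟨(p.1.1 j).proj, ((d p).left j : ℂ) • (p.1.1 j).2⟩ :=
    fun p => by
      rw [hd, ← Equiv.Perm.mul_apply, mul_inv_cancel, Equiv.Perm.one_apply]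
  refine (T.L.continuous_inner (hfst j) h1 fun p => by rw [h2]).congr fun p => ?_
  rw [h2, T.L.inner_smul_self (p.1.1.unit j)]
  rfl

end Frame

/-- Numbering the fiber over x numbers the sheets over an evenly covered neighbourhood of x. -/
theorem exists_local_sections (T : TwistedCovering n X) (x : X) :
    ∃ (U : Set X) (t : Fin n → X → T.Z), IsOpen U ∧ x ∈ U ∧ (∀ i, ContinuousOn (t i) U) ∧
      (∀ i, ∀ y ∈ U, T.s (t i y) = y) ∧ ∀ y ∈ U, Function.Injective fun i => t i y := by
  obtain ⟨-, U, hxU, hU, -, H, hH⟩ := T.isCoveringMap x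
  have hfin : (T.s ⁻¹' {x}).Finite := Set.finite_of_encard_eq_coe (T.sheets x)
  have hcard : Nat.card (T.s ⁻¹' {x}) = n := by
    rw [Nat.card_coe_set_eq, Set.ncard, T.sheets]
    rfl
  have := hfin.to_subtype
  let ε := (Finite.equivFinOfCardEq hcard).symm
  have h1 : ∀ i, Continuous fun y : U => (H.symm (y, ε i) : T.Z) := fun i => by fun_prop
  choose t ht ht' using fun i => exists_continuousOn_extend hxU (h1 i)
  refine ⟨U, t, hU, hxU, ht, fun i y hy => ?_, fun y hy i j hij => ?_⟩
  · rw [ht' i ⟨y, hy⟩, ← hH, H.apply_symm_apply]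
  · have : t i y = t j y := hij
    rw [ht' i ⟨y, hy⟩, ht' j ⟨y, hy⟩] at this
    exact ε.injective (congrArg Prod.snd (H.symm.injective (Subtype.ext this)))

section

variable [NeZero n]

theorem exists_local_frame (T : TwistedCovering n X) (x : X) :
    ∃ (U : Set X) (σ : X → T.Frame), IsOpen U ∧ x ∈ U ∧ ContinuousOn σ U ∧
      ∀ y ∈ U, (σ y).proj = y := by
  obtain ⟨U, t, hU, hxU, ht, hst, hinj⟩ := T.exists_local_sections x
  choose V u hV htV hu hu1 using fun i => T.L.exists_local_unit_section (t i x)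
  -- Each numbered sheet must land in the domain of a unit section of L. As n ≠ 0, the intersection
  -- lies in U.
  let W : Set X := ⋂ i, U ∩ t i ⁻¹' V i
  have hW : IsOpen W := isOpen_iInter_of_finite fun i => (ht i).isOpen_inter_preimage hU (hV i)
  have hxW : x ∈ W := Set.mem_iInter.2 fun i => ⟨hxU, htV i⟩
  have hWU : W ⊆ U := fun y hy => (Set.mem_iInter.1 hy 0).1
  have hWV : ∀ i, Set.MapsTo (t i) W (V i) := fun i y hy => (Set.mem_iInter.1 hy i).2
  let σ : W → T.Frame := fun y => ⟨fun i => ⟨t i y, u i (t i y)⟩, fun i => hu1 i _ (hWV i y.2),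
    hinj y (hWU y.2), fun i j => (hst i y (hWU y.2)).trans (hst j y (hWU y.2)).symm⟩
  have hσ : Continuous σ := Frame.continuous_of fun i =>
    continuousOn_iff_continuous_domRestrict.1
      ((hu i).comp ((ht i).mono hWU) (hWV i))
  obtain ⟨σ', h1, h2⟩ := exists_continuousOn_extend hxW hσ
  refine ⟨W, σ', hW, hxW, h1, fun y hy => ?_⟩
  rw [h2 ⟨y, hy⟩]
  exact hst 0 y (hWU hy)

variable [T2Space X] [LocallyCompactSpace X]

/-- The principal bundle of frames of a twisted covering. -/
noncomputable def frameBundle (T : TwistedCovering n X) : PrincipalBundle (TorusPerm n) X :=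
  have := T.L.t2Space_tot
  .ofDivision Frame.continuous_proj Frame.proj_smul Frame.div (fun _ _ => Frame.smul_div)
    Frame.div_smul Frame.continuous_div T.exists_local_frame

end

end TwistedCovering

namespace PrincipalBundle

open MulOpposite (op)

variable {G : Type*} [Group G] [TopologicalSpace G] [IsTopologicalGroup G]
  {X : Type u} [TopologicalSpace X]

/-- The action on P is free, so each point of P identifies F with the fiber of the associated
bundle. -/
theorem Assoc.mk_right_injective (A : PrincipalBundle G X) {F : Type*} [MulAction G F] {a : A.P}
    {t s : F} (h : Assoc.mk A a t = Assoc.mk A a s) : t = s := by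
  obtain ⟨g, hg, rfl⟩ := Assoc.exists_of_mk_eq A h
  have : g = 1 := A.smul_right_injective a (by rw [← hg, MulOpposite.op_one, one_smul])
  rw [this, one_smul]

/-- An isomorphism of principal bundles induces homeomorphisms of the associated bundles. -/
theorem Assoc.exists_homeomorph {A B : PrincipalBundle G X} (f : A.P ≃ₜ B.P)
    (hf : ∀ (g : G) (a : A.P), f (op g • a) = op g • f a) (F : Type*) [TopologicalSpace F]
    [MulAction G F] :
    ∃ h : A.Assoc F ≃ₜ B.Assoc F, ∀ a t, h (Assoc.mk A a t) = Assoc.mk B (f a) t := by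
  have key : ∀ {A B : PrincipalBundle G X} (f : A.P ≃ₜ B.P)
      (_ : ∀ (g : G) (a : A.P), f (op g • a) = op g • f a),
      ∃ h : A.Assoc F → B.Assoc F, Continuous h ∧
        ∀ a t, h (Assoc.mk A a t) = Assoc.mk B (f a) t := fun {A B} f hf => by
    refine ⟨Quot.map (fun p => (f p.1, p.2)) ?_, ?_, fun _ _ => rfl⟩
    · rintro p q ⟨g, rfl⟩
      exact ⟨g, by rw [hf]⟩
    · exact continuous_quot_lift _ (continuous_quot_mk.comp
        ((f.continuous.comp continuous_fst).prodMk continuous_snd))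
  obtain ⟨h, hc, h1⟩ := key f hf
  obtain ⟨h', hc', h1'⟩ := key f.symm fun g b => by
    rw [f.symm_apply_eq, hf, f.apply_symm_apply]
  refine ⟨⟨⟨h, h', fun q => ?_, fun q => ?_⟩, hc, hc'⟩, h1⟩
  · obtain ⟨a, t, rfl⟩ := Assoc.mk_surjective A q
    rw [h1, h1', f.symm_apply_apply]
  · obtain ⟨a, t, rfl⟩ := Assoc.mk_surjective B q
    rw [h1', h1, f.apply_symm_apply]

end PrincipalBundle

/-! ### The correspondence between twisted coverings and principal bundles -/

namespace TwistedCovering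

open MulOpposite (op unop)
open PrincipalBundle (Assoc)

variable {n : ℕ} {X : Type u} [TopologicalSpace X]

theorem IsAssociatedTo.of_iso {T : TwistedCovering n X} {A B : PrincipalBundle (TorusPerm n) X}
    (hT : T.IsAssociatedTo B) (hAB : A.Iso B) : T.IsAssociatedTo A := by
  obtain ⟨f, hf, hfs⟩ := hAB
  obtain ⟨h, k, hs, hk⟩ := hT
  obtain ⟨h', hh'⟩ := Assoc.exists_homeomorph f hfs (Fin n)
  obtain ⟨k', hk'⟩ := Assoc.exists_homeomorph f hfs (Fin n × ℂ)
  refine ⟨h'.trans h, k'.trans k, fun a i => ?_, fun a i => ?_⟩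
  · rw [Homeomorph.trans_apply, hh', hs, hf]
  · rw [Homeomorph.trans_apply, hh']
    obtain ⟨u, hu, hku⟩ := hk (f a) i
    exact ⟨u, hu, fun w => by rw [Homeomorph.trans_apply, hk', hku]⟩

/-- Both towers are identified with the tower of A, so one identification is composed with the
inverse of the other. -/
theorem iso_of_isAssociatedTo {S T : TwistedCovering n X} {A : PrincipalBundle (TorusPerm n) X}
    (hS : S.IsAssociatedTo A) (hT : T.IsAssociatedTo A) : S.Iso T := by
  obtain ⟨h, k, hs, hk⟩ := hS
  obtain ⟨h', k', hs', hk'⟩ := hT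
  refine (iso_iff S T).2 ⟨h.symm.trans h', fun z => ?_, k.symm.trans k', fun z => ?_⟩
  · obtain ⟨q, rfl⟩ := h.surjective z
    obtain ⟨a, i, rfl⟩ := Assoc.mk_surjective A q
    rw [Homeomorph.trans_apply, h.symm_apply_apply, hs, hs']
  · obtain ⟨q, rfl⟩ := h.surjective z
    obtain ⟨a, i, rfl⟩ := Assoc.mk_surjective A q
    rw [Homeomorph.trans_apply, h.symm_apply_apply]
    obtain ⟨u, hu, hku⟩ := hk a i
    obtain ⟨u', hu', hku'⟩ := hk' a i
    -- On this fiber the composite sends the unit vector u to u'.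
    let ℓ : S.L.E (h (.mk A a i)) ≃ₗ[ℂ] T.L.E (h' (.mk A a i)) :=
      LinearEquiv.ofLinearMap
        ((LinearMap.toSpanSingleton ℂ _ u').comp (S.L.metric _ u))
        ((LinearMap.toSpanSingleton ℂ _ u).comp (T.L.metric _ u'))
        (by ext v; simp [hu, T.L.metric_smul_eq hu'])
        (by ext v; simp [hu', S.L.metric_smul_eq hu])
    refine ⟨ℓ, fun v => ?_⟩
    change k' (k.symm ⟨_, v⟩) = ⟨_, S.L.metric _ u v • u'⟩
    rw [← hku', ← S.L.metric_smul_eq hu v, ← hku, k.symm_apply_apply, S.L.metric_smul_eq hu v]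

variable [NeZero n]

/-- Locally on Z, each point is found in a frame over its image, at a locally constant position.
This gives continuous local inverses of the evaluation maps. -/
theorem exists_local_index (T : TwistedCovering n X) (z : T.Z) :
    ∃ (V : Set T.Z) (f : T.Z → T.Frame) (i : T.Z → Fin n), IsOpen V ∧ z ∈ V ∧ ContinuousOn f V ∧
      ContinuousOn i V ∧ ∀ y ∈ V, (f y (i y)).proj = y := by
  obtain ⟨U, σ, hU, hz, hσ, hσp⟩ := T.exists_local_frame (T.s z)
  have hs : Continuous T.s := T.isCoveringMap.continuous
  have hex : ∀ y : T.s ⁻¹' U, ∃ i, (σ (T.s y) i).proj = y := fun y =>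
    Frame.exists_index (i := 0) (hσp _ y.2).symm
  choose i hi using hex
  have hc : Continuous fun y : T.s ⁻¹' U => σ (T.s y) :=
    hσ.comp_continuous (hs.comp continuous_subtype_val) fun y => y.2
  have hic : Continuous i := by
    refine (isLocallyConstant_of_isClosed_fibers fun j => ?_).continuous
    have : {y | i y = j} = {y : T.s ⁻¹' U | (σ (T.s y) j).proj = y} := by
      ext y
      refine ⟨fun h => ?_, fun h => (σ (T.s y)).injective ((hi y).trans h.symm)⟩
      rw [Set.mem_ofPred_eq, ← h, hi]
    rw [this]
    exact isClosed_eq ((Frame.continuous_base j).comp hc) continuous_subtype_val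
  obtain ⟨i', h1, h2⟩ := exists_continuousOn_extend (x := z) (U := T.s ⁻¹' U) hz hic
  refine ⟨T.s ⁻¹' U, fun y => σ (T.s y), i', hU.preimage hs, hz,
    continuousOn_iff_continuous_domRestrict.2 hc, h1, fun y hy => ?_⟩
  rw [h2 ⟨y, hy⟩]
  exact hi ⟨y, hy⟩

variable [T2Space X] [LocallyCompactSpace X]

/-- A principal bundle to which `T` is associated is isomorphic to the frame bundle of `T`. -/
theorem IsAssociatedTo.iso_frameBundle {T : TwistedCovering n X}
    {A : PrincipalBundle (TorusPerm n) X} (hT : T.IsAssociatedTo A) : A.Iso T.frameBundle := by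
  obtain ⟨h, k, hs, hk⟩ := hT
  have hk1 : ∀ a i, (k (.mk A a (i, 1))).proj = h (.mk A a i) := fun a i => by
    obtain ⟨u, hu, hku⟩ := hk a i
    rw [hku]
  have hkw : ∀ a i w, k (.mk A a (i, w)) =
      ⟨(k (.mk A a (i, 1))).proj, w • (k (.mk A a (i, 1))).2⟩ := fun a i w => by
    obtain ⟨u, hu, hku⟩ := hk a i
    rw [hku, hku, one_smul]
  -- The point a becomes the frame of the vectors [a, (i, 1)]; their base points [a, i] are distinct
  -- because the action on A is free.
  let m : A.P → T.Frame := fun a => ⟨fun i => k (.mk A a (i, 1)), fun i => by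
      obtain ⟨u, hu, hku⟩ := hk a i
      have hv : ∀ v : T.L.Tot, v = ⟨h (.mk A a i), u⟩ → T.L.metric _ v.2 v.2 = 1 := by
        rintro _ rfl
        exact hu
      exact hv _ ((hku 1).trans (by rw [one_smul])),
    fun i j hij => by
      dsimp only at hij
      rw [hk1, hk1] at hij
      exact Assoc.mk_right_injective A (h.injective hij),
    fun i j => by rw [hk1, hk1, hs, hs]⟩
  have hm : Continuous m := Frame.continuous_of fun i => k.continuous.comp
    ((Assoc.continuous_mk A).comp (continuous_id.prodMk continuous_const))
  refine PrincipalBundle.iso_of_equivariant (B := T.frameBundle) m hm (fun a => ?_) fun g a => ?_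
  · change T.s (k (.mk A a (0, 1))).proj = A.proj a
    rw [hk1, hs]
  · refine Frame.ext fun i => ?_
    change k (.mk A (op g • a) (i, 1)) = (op g • m a) i
    rw [Frame.smul_apply, Assoc.mk_smul, TorusPerm.smul_prod_def, hkw, mul_one]

/-- The identifications are the evaluations [f, i] ↦ base point of f(i) and [f, (i, w)] ↦ w · f(i).
-/
theorem isAssociatedTo_frameBundle (T : TwistedCovering n X) :
    T.IsAssociatedTo T.frameBundle := by
  have hπ := FiberBundle.continuous_proj ℂ T.L.E
  have hbase : ∀ (g : TorusPerm n) (f : T.Frame) (p : Fin n × ℂ),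
      ((⟨((op g • f) (g⁻¹ • p).1).proj, (g⁻¹ • p).2 • ((op g • f) (g⁻¹ • p).1).2⟩ : T.L.Tot)) =
        ⟨(f p.1).proj, p.2 • (f p.1).2⟩ := fun g f p => by
    obtain ⟨q, rfl⟩ : ∃ q, p = g • q := ⟨g⁻¹ • p, by rw [smul_inv_smul]⟩
    rw [inv_smul_smul, Frame.smul_apply, TorusPerm.smul_prod_def]
    dsimp only
    rw [smul_smul, mul_comm]
  let h₀ : T.frameBundle.Assoc (Fin n) → T.Z := Quot.lift (fun p : T.Frame × Fin n =>
    (p.1 p.2).proj) (by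
      rintro ⟨f, i⟩ q ⟨g, rfl⟩
      -- Only the base point matters here; the scalar 0 is arbitrary.
      exact (congrArg TotalSpace.proj (hbase g f (i, 0))).symm)
  let k₀ : T.frameBundle.Assoc (Fin n × ℂ) → T.L.Tot := Quot.lift (fun p : T.Frame × (Fin n × ℂ) =>
    ⟨(p.1 p.2.1).proj, p.2.2 • (p.1 p.2.1).2⟩) (by
      rintro ⟨f, p⟩ q ⟨g, rfl⟩
      exact (hbase g f p).symm)
  have hev : ∀ {Y : Type u} [TopologicalSpace Y] {f : Y → T.Frame} {i : Y → Fin n}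
      (_ : Continuous f) (_ : Continuous i), Continuous fun y => f y (i y) := fun hf hi =>
    ((IsLocallyConstant.iff_continuous _).2 hi).continuous_eval
      fun j => (Frame.continuous_apply j).comp hf
  have hh₀ : Continuous h₀ := continuous_quot_lift _ (hπ.comp
    (hev (continuous_fst : Continuous (Prod.fst : T.Frame × Fin n → _)) continuous_snd))
  have hk₀ : Continuous k₀ := continuous_quot_lift _ (T.L.continuous_smul.comp
    ((continuous_snd.comp continuous_snd).prodMk
      (hev (continuous_fst : Continuous (Prod.fst : T.Frame × (Fin n × ℂ) → _))
        (continuous_fst.comp continuous_snd))))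
  -- Two classes over the same point of X can be written with a common frame, which reduces
  -- injectivity to a single frame.
  have hrep : ∀ {F : Type} [MulAction (TorusPerm n) F] (q q' : T.frameBundle.Assoc F),
      Assoc.proj _ F q = Assoc.proj _ F q' →
      ∃ (f : T.Frame) (t t' : F), Assoc.mk T.frameBundle f t = q ∧
        Assoc.mk T.frameBundle f t' = q' := by
    intro F _ q q' hqq
    obtain ⟨f, t, rfl⟩ := Assoc.mk_surjective _ q
    obtain ⟨t', ht'⟩ := Assoc.exists_rep_of_proj_eq _ hqq.symm
    exact ⟨f, t, t', rfl, ht'⟩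
  have hh₀s : ∀ q, T.s (h₀ q) = Assoc.proj _ _ q := fun q => by
    obtain ⟨f, i, rfl⟩ := Assoc.mk_surjective _ q
    exact Frame.s_base (T := T) f i
  have hk₀s : ∀ q, T.s (k₀ q).proj = Assoc.proj _ _ q := fun q => by
    obtain ⟨f, i, rfl⟩ := Assoc.mk_surjective _ q
    exact Frame.s_base (T := T) f i.1
  have hh₀b : Function.Bijective h₀ := by
    refine ⟨fun q q' hqq => ?_, fun z => ?_⟩
    · obtain ⟨f, i, j, rfl, rfl⟩ := hrep q q' (by rw [← hh₀s, hqq, hh₀s])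
      rw [f.injective (a₁ := i) (a₂ := j) hqq]
    · obtain ⟨V, f, i, -, hz, -, -, hV⟩ := T.exists_local_index z
      exact ⟨Assoc.mk T.frameBundle (f z) (i z), hV z hz⟩
  have hk₀b : Function.Bijective k₀ := by
    refine ⟨fun q q' hqq => ?_, fun v => ?_⟩
    · obtain ⟨f, ⟨i, w⟩, ⟨j, w'⟩, rfl, rfl⟩ := hrep q q' (by rw [← hk₀s, hqq, hk₀s])
      obtain rfl : i = j := f.injective (by
        have := congrArg TotalSpace.proj hqq
        exact this)
      have h2 : T.L.inner (f i) ⟨(f i).proj, w • (f i).2⟩ =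
        T.L.inner (f i) ⟨(f i).proj, w' • (f i).2⟩ := congrArg (T.L.inner (f i)) hqq
      rw [T.L.inner_smul_self (f.unit i), T.L.inner_smul_self (f.unit i)] at h2
      rw [h2]
    · obtain ⟨V, f, i, -, hz, -, -, hV⟩ := T.exists_local_index v.proj
      exact ⟨Assoc.mk T.frameBundle (f v.proj) (i v.proj, T.L.inner (f v.proj (i v.proj)) v),
        T.L.inner_smul_eq ((f _).unit _) (hV _ hz).symm⟩
  let h : T.frameBundle.Assoc (Fin n) ≃ T.Z := Equiv.ofBijective h₀ hh₀b
  let k : T.frameBundle.Assoc (Fin n × ℂ) ≃ T.L.Tot := Equiv.ofBijective k₀ hk₀b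
  have hh : Continuous h.symm := continuous_iff_continuousAt.2 fun z => by
    obtain ⟨V, f, i, hV, hz, hf, hi, hVi⟩ := T.exists_local_index z
    have h1 : ContinuousOn (fun y => Assoc.mk T.frameBundle (f y) (i y)) V :=
      (Assoc.continuous_mk T.frameBundle (F := Fin n)).comp_continuousOn (hf.prodMk hi)
    refine (h1.continuousAt (hV.mem_nhds hz)).congr ?_
    filter_upwards [hV.mem_nhds hz] with y hy
    rw [Equiv.eq_symm_apply]
    exact hVi y hy
  -- Near v the inverse is w ↦ [f, (i, ⟨f(i), w⟩)], with f a local frame and i the position of the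
  -- base point of w.
  have hk : Continuous k.symm := continuous_iff_continuousAt.2 fun v => by
    obtain ⟨V, f, i, hV, hz, hf, hi, hVi⟩ := T.exists_local_index v.proj
    have hV' : IsOpen ((TotalSpace.proj : T.L.Tot → T.Z) ⁻¹' V) := hV.preimage hπ
    rw [continuousOn_iff_continuous_domRestrict] at hf hi
    have hp : Continuous fun w : (TotalSpace.proj : T.L.Tot → T.Z) ⁻¹' V =>
        (⟨w.1.proj, w.2⟩ : V) := (hπ.comp continuous_subtype_val).subtype_mk _
    have h1 : ContinuousOn (fun w : T.L.Tot =>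
        (f w.proj, (i w.proj, T.L.inner (f w.proj (i w.proj)) w))) (TotalSpace.proj ⁻¹' V) := by
      refine continuousOn_iff_continuous_domRestrict.2
        ((hf.comp hp).prodMk ((hi.comp hp).prodMk ?_))
      exact T.L.continuous_inner (hev (hf.comp hp) (hi.comp hp)) continuous_subtype_val
        fun w => (hVi _ w.2).symm
    have h2 : Continuous fun p : T.Frame × (Fin n × ℂ) => Assoc.mk T.frameBundle p.1 p.2 :=
      Assoc.continuous_mk T.frameBundle
    refine ((h2.comp_continuousOn h1).continuousAt (hV'.mem_nhds hz)).congr ?_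
    filter_upwards [hV'.mem_nhds hz] with w hw
    rw [Equiv.eq_symm_apply]
    exact T.L.inner_smul_eq ((f _).unit _) (hVi _ hw).symm
  refine ⟨⟨h, hh₀, hh⟩, ⟨k, hk₀, hk⟩, fun f i => hh₀s (Assoc.mk T.frameBundle f i),
    fun f i => ?_⟩
  exact ⟨((show T.Frame from f) i).2, Frame.unit (T := T) f i, fun w => rfl⟩

/-- Isomorphic twisted coverings have isomorphic frame bundles. -/
theorem Iso.frameBundle_iso {S T : TwistedCovering n X} (h : S.Iso T) :
    S.frameBundle.Iso T.frameBundle := by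
  obtain ⟨φ, hs, F, hF⟩ := (iso_iff S T).1 h
  choose ℓ hℓ using hF
  have hF' : ∀ v : S.L.Tot, F v = ⟨φ v.proj, ℓ v.proj v.2⟩ := fun v => hℓ v.proj v.2
  have hF0 : ∀ (f : S.Frame) i, (F (f i)).2 ≠ 0 := fun f i => by
    rw [hF']
    exact (ℓ _).map_ne_zero_iff.2 (S.L.ne_zero_of_metric_self_eq_one (f.unit i))
  have hproj : ∀ v : S.L.Tot, (T.L.normalize (F v)).proj = φ v.proj := fun v => by
    rw [hF']
    rfl
  have hsmul : ∀ (c : Circle) (z : S.Z) (v : S.L.E z), T.L.normalize (F ⟨z, (c : ℂ) • v⟩) =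
      ⟨(T.L.normalize (F ⟨z, v⟩)).proj, (c : ℂ) • (T.L.normalize (F ⟨z, v⟩)).2⟩ := fun c z v => by
    rw [hF', hF', map_smul]
    exact T.L.normalize_circle_smul _ _ _
  -- F is linear on the fibers but perhaps not isometric, so the images of the frame vectors are
  -- normalized.
  let m : S.Frame → T.Frame := fun f => ⟨fun i => T.L.normalize (F (f i)),
    fun i => T.L.metric_normalize (hF0 f i),
    fun i j hij => by
      dsimp only at hij
      rw [hproj, hproj] at hij
      exact f.injective (φ.injective hij),
    fun i j => by rw [hproj, hproj, hs, hs, f.s_base, f.s_base]⟩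
  have hm : Continuous m := Frame.continuous_of fun i =>
    T.L.continuous_normalize (F.continuous.comp (Frame.continuous_apply i)) fun f => hF0 f i
  refine PrincipalBundle.iso_of_equivariant (A := S.frameBundle) (B := T.frameBundle) m hm
    (fun f => ?_) fun g f => Frame.ext fun i => ?_
  · change T.s (T.L.normalize (F (Subtype.val f 0))).proj = S.s (Subtype.val f 0).proj
    rw [hproj, hs]
  · exact hsmul _ _ _

end TwistedCovering

/-! ### The twisted covering associated to a principal bundle -/

namespace PrincipalBundle

open MulOpposite (op)

variable {n : ℕ} {X : Type u} [TopologicalSpace X] (A : PrincipalBundle (TorusPerm n) X)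

/-- The projection `P ×_G ({1, …, n} × ℂ) → P ×_G {1, …, n}`. -/
noncomputable def Assoc.base : A.Assoc (Fin n × ℂ) → A.Assoc (Fin n) :=
  Quot.lift (fun p => Assoc.mk A p.1 p.2.1) (by
    rintro p q ⟨g, rfl⟩
    exact Quot.sound ⟨g, rfl⟩)

theorem Assoc.base_mk (a : A.P) (p : Fin n × ℂ) :
    Assoc.base A (Assoc.mk A a p) = Assoc.mk A a p.1 := rfl

theorem Assoc.continuous_base : Continuous (Assoc.base A) :=
  continuous_quot_lift _ ((Assoc.continuous_mk A).comp
    (continuous_fst.prodMk (continuous_fst.comp continuous_snd)))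

theorem Assoc.proj_base (q : A.Assoc (Fin n × ℂ)) :
    Assoc.proj A _ (Assoc.base A q) = Assoc.proj A _ q := by
  obtain ⟨a, p, rfl⟩ := Assoc.mk_surjective A q
  rfl

/-- The fibers of the line bundle `P ×_G ({1, …, n} × ℂ)` over `P ×_G {1, …, n}`; a point over `z`
is given by its coordinate with respect to a chosen representative of `z`. -/
def LineFiber (_ : A.Assoc (Fin n)) : Type u := ULift.{u} ℂ

namespace LineFiber

variable (z : A.Assoc (Fin n))

noncomputable instance : AddCommGroup (A.LineFiber z) := inferInstanceAs (AddCommGroup (ULift ℂ))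

noncomputable instance : Module ℂ (A.LineFiber z) := inferInstanceAs (Module ℂ (ULift ℂ))

/-- The coordinate of a point of the fiber. -/
noncomputable def coord : A.LineFiber z ≃ₗ[ℂ] ℂ := ULift.moduleEquiv

/-- The point of `P ×_G ({1, …, n} × ℂ)` with a given coordinate. -/
noncomputable def toAssoc (v : TotalSpace ℂ A.LineFiber) : A.Assoc (Fin n × ℂ) :=
  Assoc.mk A v.proj.out.1 (v.proj.out.2, coord A v.proj v.2)

theorem mk_out : Assoc.mk A z.out.1 z.out.2 = z := Quot.out_eq z

theorem base_toAssoc (v : TotalSpace ℂ A.LineFiber) : Assoc.base A (toAssoc A v) = v.proj :=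
  mk_out A v.proj

/-- The chosen representative of [a, i] is (a · g, g⁻¹ i) for some g, and passing to it multiplies
the coordinate by the inverse of the phase of g at i. -/
theorem exists_unit (a : A.P) (i : Fin n) : ∃ u : Circle, ∀ w : ℂ,
    toAssoc A ⟨Assoc.mk A a i, (coord A _).symm (w * u)⟩ = Assoc.mk A a (i, w) := by
  obtain ⟨g, hg, hi⟩ := Assoc.exists_of_mk_eq A (mk_out A (Assoc.mk A a i)).symm
  refine ⟨(g.left i)⁻¹, fun w => ?_⟩
  rw [toAssoc, LinearEquiv.apply_symm_apply]
  dsimp only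
  rw [hg, Assoc.mk_smul, TorusPerm.smul_prod_def]
  dsimp only
  rw [← TorusPerm.smul_fin_def, ← hi, mul_left_comm, ← Circle.coe_mul, mul_inv_cancel,
    Circle.coe_one, mul_one]

theorem toAssoc_bijective : Function.Bijective (toAssoc A) := by
  constructor
  · rintro ⟨z, v⟩ ⟨z', v'⟩ h
    have hz := congrArg (Assoc.base A) h
    rw [base_toAssoc, base_toAssoc] at hz
    obtain rfl : z = z' := hz
    have := Assoc.mk_right_injective A h
    exact congrArg (TotalSpace.mk z) ((coord A z).injective (congrArg Prod.snd this))
  · intro q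
    obtain ⟨a, ⟨i, w⟩, rfl⟩ := Assoc.mk_surjective A q
    obtain ⟨u, hu⟩ := exists_unit A a i
    exact ⟨_, hu w⟩

/-- The chosen coordinates need not vary continuously with z, so the topology is taken from the
associated bundle. -/
noncomputable instance : TopologicalSpace (TotalSpace ℂ A.LineFiber) :=
  .induced (toAssoc A) inferInstance

/-- The total space of the line bundle is `P ×_G ({1, …, n} × ℂ)`. -/
noncomputable def homeomorph : TotalSpace ℂ A.LineFiber ≃ₜ A.Assoc (Fin n × ℂ) :=
  (Equiv.ofBijective _ (toAssoc_bijective A)).toHomeomorphOfIsInducing ⟨rfl⟩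

theorem homeomorph_apply (v : TotalSpace ℂ A.LineFiber) : homeomorph A v = toAssoc A v := rfl

theorem proj_homeomorph_symm (q : A.Assoc (Fin n × ℂ)) :
    ((homeomorph A).symm q).proj = Assoc.base A q := by
  rw [← base_toAssoc, ← homeomorph_apply, Homeomorph.apply_symm_apply]

noncomputable instance : TopologicalSpace (A.LineFiber z) :=
  .induced (TotalSpace.mk' ℂ z) inferInstance

/-- An equivariant trivialization of A gives a point of the line bundle an index and a scalar. The
index is that of its base point, so the scalar alone is a fiber coordinate. It differs from `coord`
by a phase, hence is linear and isometric on fibers. -/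
theorem exists_trivialization (x : X) :
    ∃ t : Trivialization ℂ (TotalSpace.proj : TotalSpace ℂ A.LineFiber → A.Assoc (Fin n)),
      (∀ z, Assoc.proj A (Fin n) z = x → z ∈ t.baseSet) ∧
      ∀ z ∈ t.baseSet, ∃ c : Circle, ∀ v, (t ⟨z, v⟩).2 = c * coord A z v := by
  obtain ⟨e, hx, he⟩ := A.locallyTrivial x
  obtain ⟨e₁, hb₁, h₁, -⟩ := Assoc.exists_trivialization A (Fin n) e he
  obtain ⟨e₂, hb₂, h₂, -⟩ := Assoc.exists_trivialization A (Fin n × ℂ) e he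
  set V : Set (A.Assoc (Fin n)) := Assoc.proj A (Fin n) ⁻¹' e.baseSet with hV
  have hVo : IsOpen V := e.open_baseSet.preimage (Assoc.continuous_proj A (Fin n))
  have hp : Continuous (TotalSpace.proj : TotalSpace ℂ A.LineFiber → A.Assoc (Fin n)) :=
    ((Assoc.continuous_base A).comp (homeomorph A).continuous).congr (base_toAssoc A)
  have hind : ∀ q, Assoc.proj A _ q ∈ e.baseSet → (e₁ (Assoc.base A q)).2 = (e₂ q).2.1 :=
    fun q hq => by
      obtain ⟨a, p, rfl⟩ := Assoc.mk_surjective A q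
      rw [Assoc.base_mk, h₁ a _ hq, h₂ a _ hq]
      rfl
  have hVq : ∀ v : TotalSpace ℂ A.LineFiber, v.proj ∈ V →
      Assoc.proj A _ (homeomorph A v) ∈ e.baseSet := fun v hv => by
    rwa [← Assoc.proj_base, homeomorph_apply, base_toAssoc]
  -- The class with the index of z lies over z, whatever its scalar c.
  have hbase : ∀ z ∈ V, ∀ c, Assoc.base A
      (e₂.toOpenPartialHomeomorph.symm (Assoc.proj A _ z, ((e₁ z).2, c))) = z := fun z hz c => by
    have h1 : Assoc.proj A _ (e₂.toOpenPartialHomeomorph.symm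
        (Assoc.proj A _ z, ((e₁ z).2, c))) = Assoc.proj A _ z :=
      e₂.proj_symm_apply' (hb₂ ▸ hz)
    refine e₁.eq_of_proj_eq_of_snd_eq ?_ ?_ ?_
    · rw [Assoc.proj_base, h1, hb₁]
      exact hz
    · rw [Assoc.proj_base, h1]
    · rw [hind _ (by rw [h1]; exact hz), e₂.apply_symm_apply' (hb₂ ▸ hz)]
  refine ⟨{
    toFun := fun v => (v.proj, (e₂ (homeomorph A v)).2.2)
    invFun := fun p => (homeomorph A).symm
      (e₂.toOpenPartialHomeomorph.symm (Assoc.proj A _ p.1, ((e₁ p.1).2, p.2)))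
    source := TotalSpace.proj ⁻¹' V
    target := V ×ˢ Set.univ
    baseSet := V
    map_source' := fun v hv => ⟨hv, trivial⟩
    map_target' := fun p hp => by
      rw [Set.mem_preimage, proj_homeomorph_symm, hbase _ hp.1]
      exact hp.1
    left_inv' := fun v hv => ?_
    right_inv' := fun p hp => ?_
    open_source := hVo.preimage hp
    open_target := hVo.prod isOpen_univ
    open_baseSet := hVo
    source_eq := rfl
    target_eq := rfl
    proj_toFun := fun _ _ => rfl
    continuousOn_toFun := ?_
    continuousOn_invFun := ?_ }, fun z hz => ?_, fun z hz => ?_⟩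
  · rw [Homeomorph.symm_apply_eq]
    have h1 := hVq v hv
    have h2 : Assoc.base A (homeomorph A v) = v.proj := base_toAssoc A v
    rw [← h2, hind _ h1, Assoc.proj_base]
    exact e₂.symm_apply_mk_proj (e₂.mem_source.2 (hb₂ ▸ h1))
  · refine Prod.ext ?_ ?_
    · rw [proj_homeomorph_symm, hbase _ hp.1]
    · rw [Homeomorph.apply_symm_apply, e₂.apply_symm_apply' (hb₂ ▸ hp.1)]
  · refine hp.continuousOn.prodMk ?_
    have h1 : ContinuousOn (fun v => e₂ (homeomorph A v)) (TotalSpace.proj ⁻¹' V) :=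
      e₂.continuousOn_toFun.comp (homeomorph A).continuous.continuousOn
        fun v hv => e₂.mem_source.2 (hb₂ ▸ hVq v hv)
    exact h1.snd.snd
  · refine (homeomorph A).symm.continuous.comp_continuousOn ?_
    refine e₂.continuousOn_invFun.comp ?_ fun p hp => e₂.mem_target.2 (hb₂ ▸ hp.1)
    have h1 : ContinuousOn (fun p : A.Assoc (Fin n) × ℂ => e₁ p.1) (V ×ˢ Set.univ) :=
      e₁.continuousOn_toFun.comp continuousOn_fst fun p hp => e₁.mem_source.2 (hb₁ ▸ hp.1)
    exact ((Assoc.continuous_proj A _).comp continuous_fst).continuousOn.prodMk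
      (h1.snd.prodMk continuousOn_snd)
  · have : Assoc.proj A (Fin n) z ∈ e.baseSet := hz ▸ hx
    exact this
  · refine ⟨(e z.out.1).2.left ((e z.out.1).2.right z.out.2), fun v => ?_⟩
    have h1 : A.proj z.out.1 ∈ e.baseSet := by
      rw [← Assoc.proj_mk A z.out.1 z.out.2, mk_out]
      exact hz
    change (e₂ (Assoc.mk A z.out.1 (z.out.2, coord A z v))).2.2 = _
    rw [h₂ _ _ h1]
    rfl

/-- A trivialization of the line bundle near the points over a given point of `X`. -/
noncomputable def triv (x : X) :
    Trivialization ℂ (TotalSpace.proj : TotalSpace ℂ A.LineFiber → A.Assoc (Fin n)) :=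
  (exists_trivialization A x).choose

theorem mem_baseSet_triv : z ∈ (triv A (Assoc.proj A _ z)).baseSet :=
  (exists_trivialization A _).choose_spec.1 z rfl

variable {z} in
theorem triv_apply (x : X) (hz : z ∈ (triv A x).baseSet) :
    ∃ c : Circle, ∀ v, (triv A x ⟨z, v⟩).2 = c * coord A z v :=
  (exists_trivialization A x).choose_spec.2 z hz

noncomputable instance : FiberBundle ℂ A.LineFiber where
  totalSpaceMk_isInducing' _ := ⟨rfl⟩
  trivializationAtlas' := Set.range (triv A)
  trivializationAt' z := triv A (Assoc.proj A _ z)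
  mem_baseSet_trivializationAt' := mem_baseSet_triv A
  trivialization_mem_atlas' _ := ⟨_, rfl⟩

instance (x : X) : (triv A x).IsLinear ℂ where
  linear _ hz := by
    obtain ⟨c, hc⟩ := triv_apply A x hz
    constructor
    · intro v w
      rw [hc, hc, hc, map_add, mul_add]
    · intro a v
      rw [hc, hc, map_smul, smul_eq_mul, smul_eq_mul, mul_left_comm]

instance : VectorBundle ℂ ℂ A.LineFiber where
  trivialization_linear' := by
    intro t ht
    obtain ⟨x, rfl⟩ : t ∈ Set.range (triv A) := ht.out
    infer_instance
  continuousOn_coordChange' := by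
    intro t t' ht ht'
    obtain ⟨x, rfl⟩ : t ∈ Set.range (triv A) := ht.out
    obtain ⟨y, rfl⟩ : t' ∈ Set.range (triv A) := ht'.out
    -- As ℂ is finite-dimensional, continuity of an operator-valued map can be tested on vectors.
    refine continuousOn_clm_apply.2 fun w => ?_
    have h1 : ContinuousOn (fun z => triv A y ⟨z, (triv A x).symm z w⟩)
        ((triv A x).baseSet ∩ (triv A y).baseSet) := by
      have h2 : ContinuousOn (fun z : A.Assoc (Fin n) => (z, w))
          ((triv A x).baseSet ∩ (triv A y).baseSet) := by fun_prop
      refine (triv A y).continuousOn_toFun.comp (f := fun z => ⟨z, (triv A x).symm z w⟩)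
        ((triv A x).continuousOn_symm.comp h2 fun z hz => ⟨hz.1, trivial⟩) fun z hz => ?_
      exact (triv A y).mem_source.2 hz.2
    refine h1.snd.congr fun z hz => ?_
    exact Trivialization.coordChangeL_apply (R := ℂ) (triv A x) (triv A y) hz w

/-- The metric of the line bundle `P ×_G ({1, …, n} × ℂ)`. -/
noncomputable def metric : A.LineFiber z →ₗ⋆[ℂ] A.LineFiber z →ₗ[ℂ] ℂ :=
  LinearMap.mk₂'ₛₗ (starRingEnd ℂ) (RingHom.id ℂ) (fun v w => conj (coord A z v) * coord A z w)
    (fun _ _ _ => by rw [map_add, map_add, add_mul])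
    (fun _ _ _ => by rw [map_smul, smul_eq_mul, map_mul, smul_eq_mul, mul_assoc])
    (fun _ _ _ => by rw [map_add, mul_add])
    (fun _ _ _ => by rw [map_smul, smul_eq_mul, RingHom.id_apply, smul_eq_mul, mul_left_comm])

variable {z} in
theorem metric_apply (v w : A.LineFiber z) :
    metric A z v w = conj (coord A z v) * coord A z w := rfl

end LineFiber

/-- The Hermitian line bundle `P ×_G ({1, …, n} × ℂ)` over `P ×_G {1, …, n}`. -/
noncomputable def lineBundle : HermitianLineBundle (A.Assoc (Fin n)) where
  E := A.LineFiber
  metric := LineFiber.metric A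
  metric_symm z v w := by
    rw [LineFiber.metric_apply, LineFiber.metric_apply, map_mul, Complex.conj_conj, mul_comm]
  metric_pos z v hv := by
    rw [LineFiber.metric_apply, ← Complex.normSq_eq_conj_mul_self, Complex.ofReal_re]
    exact Complex.normSq_pos.2 ((LineFiber.coord A z).map_ne_zero_iff.2 hv)
  metric_continuous := by
    refine continuous_iff_continuousAt.2 fun v => ?_
    have hp := FiberBundle.continuous_proj ℂ A.LineFiber
    have hd := (FiberBundle.Prod.isInducing_diag ℂ A.LineFiber ℂ A.LineFiber).continuous
    set t := LineFiber.triv A (Assoc.proj A _ v.proj)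
    have hv : v.proj ∈ t.baseSet := LineFiber.mem_baseSet_triv A v.proj
    have ht : ∀ w : A.LineFiber v.proj, ContinuousAt t ⟨v.proj, w⟩ := fun w =>
      t.toOpenPartialHomeomorph.continuousAt (t.mem_source.2 hv)
    have h1 : ContinuousAt (fun w : TotalSpace (ℂ × ℂ) (A.LineFiber ×ᵇ A.LineFiber) =>
        (t ⟨w.proj, w.2.1⟩).2) v :=
      ((ht v.2.1).comp (f := fun w : TotalSpace (ℂ × ℂ) (A.LineFiber ×ᵇ A.LineFiber) =>
        (⟨w.proj, w.2.1⟩ : TotalSpace ℂ A.LineFiber)) (continuous_fst.comp hd).continuousAt).snd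
    have h2 : ContinuousAt (fun w : TotalSpace (ℂ × ℂ) (A.LineFiber ×ᵇ A.LineFiber) =>
        (t ⟨w.proj, w.2.2⟩).2) v :=
      ((ht v.2.2).comp (f := fun w : TotalSpace (ℂ × ℂ) (A.LineFiber ×ᵇ A.LineFiber) =>
        (⟨w.proj, w.2.2⟩ : TotalSpace ℂ A.LineFiber)) (continuous_snd.comp hd).continuousAt).snd
    -- In the trivialization the metric is the standard inner product, since the phase c cancels.
    refine ((Complex.continuous_conj.continuousAt.comp h1).mul h2).congr ?_
    filter_upwards [(t.open_baseSet.preimage (hp.comp (continuous_fst.comp hd))).mem_nhds hv]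
      with w hw
    have hw' : w.proj ∈ t.baseSet := hw
    obtain ⟨c, hc⟩ := LineFiber.triv_apply A _ hw'
    change conj (t ⟨w.proj, w.2.1⟩).2 * (t ⟨w.proj, w.2.2⟩).2 = _
    rw [hc, hc, LineFiber.metric_apply, map_mul, mul_mul_mul_comm,
      ← Complex.normSq_eq_conj_mul_self, Circle.normSq_coe, Complex.ofReal_one, one_mul]

variable [NeZero n] [T2Space X] [LocallyCompactSpace X]

/-- The twisted covering associated to a principal bundle. -/
noncomputable def twistedCovering : TwistedCovering n X :=
  have ht : ∀ x, ∃ e : Trivialization (Fin n) (Assoc.proj A (Fin n)), x ∈ e.baseSet := fun x => by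
    obtain ⟨e, hx, he⟩ := A.locallyTrivial x
    obtain ⟨e₁, h, -⟩ := Assoc.exists_trivialization A (Fin n) e he
    exact ⟨e₁, h ▸ hx⟩
  { Z := A.Assoc (Fin n)
    lc := locallyCompactSpace_of_trivializations ht
    t2 := t2Space_of_trivializations ht
    s := Assoc.proj A (Fin n)
    isCoveringMap := fun x => by
      obtain ⟨e, he⟩ := ht x
      exact (IsEvenlyCovered.of_trivialization he).to_isEvenlyCovered_preimage
    surjective := fun x => by
      obtain ⟨a, ha⟩ := A.surjective_proj x
      exact ⟨Assoc.mk A a 0, ha⟩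
    sheets := fun x => by
      obtain ⟨e, he⟩ := ht x
      rw [Set.encard,
        ENat.card_congr (e.preimageSingletonHomeomorph he).toEquiv]
      simp
    L := A.lineBundle }

/-- Z is the associated bundle itself; the vector [a, (i, 1)] is a unit vector because its
coordinate is a phase. -/
theorem isAssociatedTo_twistedCovering : A.twistedCovering.IsAssociatedTo A := by
  refine ⟨Homeomorph.refl _, (LineFiber.homeomorph A).symm, fun a i => rfl, fun a i => ?_⟩
  obtain ⟨u, hu⟩ := LineFiber.exists_unit A a i
  refine ⟨(LineFiber.coord A (Assoc.mk A a i)).symm u, ?_, fun w => ?_⟩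
  · change conj (LineFiber.coord A _ ((LineFiber.coord A (Assoc.mk A a i)).symm (u : ℂ))) *
      LineFiber.coord A _ ((LineFiber.coord A (Assoc.mk A a i)).symm (u : ℂ)) = 1
    rw [LinearEquiv.apply_symm_apply, ← Complex.normSq_eq_conj_mul_self, Circle.normSq_coe,
      Complex.ofReal_one]
  · refine (LineFiber.homeomorph A).symm_apply_eq.2 ?_
    refine (hu w).symm.trans (congrArg (fun v => LineFiber.toAssoc A ⟨Assoc.mk A a i, v⟩) ?_)
    exact (LineFiber.coord A (Assoc.mk A a i)).symm.map_smul w (u : ℂ)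

end PrincipalBundle

/-! ### Reductions to `Sₙ` -/

theorem TorusPerm.mem_permSubgroup_iff {n : ℕ} {g : TorusPerm n} :
    g ∈ TorusPerm.permSubgroup n ↔ g.left = 1 :=
  ⟨by rintro ⟨σ, rfl⟩; rfl, fun h => ⟨g.right, SemidirectProduct.ext h.symm rfl⟩⟩

namespace PrincipalBundle

open MulOpposite (op)

section Division

variable {G : Type*} [Group G] [TopologicalSpace G] [IsTopologicalGroup G]
  {X : Type u} [TopologicalSpace X] (A : PrincipalBundle G X)

open Classical in
/-- The element of the structure group which carries a point to another point of its fiber. -/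
noncomputable def div (a b : A.P) : G :=
  if h : A.proj a = A.proj b then (A.exists_smul_eq h).choose else 1

theorem smul_div {a b : A.P} (h : A.proj a = A.proj b) : op (A.div a b) • a = b := by
  rw [div, dif_pos h]
  exact (A.exists_smul_eq h).choose_spec

/-- In an equivariant trivialization e the division is e(a)⁻¹ e(b). -/
theorem continuous_div :
    Continuous fun p : {p : A.P × A.P // A.proj p.1 = A.proj p.2} => A.div p.1.1 p.1.2 := by
  refine continuous_iff_continuousAt.2 fun p => ?_
  obtain ⟨e, he, hes⟩ := A.locallyTrivial (A.proj p.1.1)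
  have h1 : Continuous fun p : {p : A.P × A.P // A.proj p.1 = A.proj p.2} => p.1.1 :=
    continuous_fst.comp continuous_subtype_val
  have h2 : Continuous fun p : {p : A.P × A.P // A.proj p.1 = A.proj p.2} => p.1.2 :=
    continuous_snd.comp continuous_subtype_val
  have h3 : ContinuousAt (fun q : {p : A.P × A.P // A.proj p.1 = A.proj p.2} =>
      (e q.1.1).2⁻¹ * (e q.1.2).2) p :=
    (ContinuousAt.comp (f := fun q : {p : A.P × A.P // A.proj p.1 = A.proj p.2} => q.1.1)
      (e.toOpenPartialHomeomorph.continuousAt (e.mem_source.2 he)) h1.continuousAt).snd.inv.mul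
    (ContinuousAt.comp (f := fun q : {p : A.P × A.P // A.proj p.1 = A.proj p.2} => q.1.2)
      (e.toOpenPartialHomeomorph.continuousAt (e.mem_source.2 (p.2 ▸ he))) h2.continuousAt).snd
  refine h3.congr ?_
  filter_upwards [(e.open_baseSet.preimage (A.continuous_proj.comp h1)).mem_nhds he] with q hq
  have := hes (A.div q.1.1 q.1.2) q.1.1 hq
  rw [A.smul_div q.2] at this
  rw [this, inv_mul_cancel_left]

end Division

variable {n : ℕ} {X : Type u} [TopologicalSpace X] [T2Space X] [LocallyCompactSpace X]

/-- An equivariant map to `𝕋ⁿ = (𝕋ⁿ ⋊ Sₙ) / Sₙ` reduces the bundle to `Sₙ`. -/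
theorem reducesTo_of_phase (A : PrincipalBundle (TorusPerm n) X) (c : A.P → Fin n → Circle)
    (hc : Continuous c)
    (hcs : ∀ (g : TorusPerm n) a i, c (op g • a) i = g.left (g.right i) * c a (g.right i)) :
    A.ReducesTo (TorusPerm.permSubgroup n) := by
  -- Finiteness makes the structure group locally compact, as `ofDivision` requires.
  have : Finite (TorusPerm.permSubgroup n) := Set.finite_range _
  let Q : Type u := {a : A.P // c a = 1}
  let _ : MulAction (TorusPerm.permSubgroup n)ᵐᵒᵖ Q :=
    { smul := fun g a => ⟨op (g.unop : TorusPerm n) • a.1, funext fun i => by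
        rw [hcs, a.2, TorusPerm.mem_permSubgroup_iff.1 g.unop.2]
        simp⟩
      one_smul := fun a => Subtype.ext (one_smul _ a.1)
      mul_smul := fun g h a => Subtype.ext
        (mul_smul (op (g.unop : TorusPerm n)) (op (h.unop : TorusPerm n)) a.1) }
  have : ContinuousSMul (TorusPerm.permSubgroup n)ᵐᵒᵖ Q :=
    ⟨((MulOpposite.continuous_op.comp (continuous_subtype_val.comp
      (MulOpposite.continuous_unop.comp continuous_fst))).smul
        (continuous_subtype_val.comp continuous_snd)).subtype_mk _⟩
  -- If a and a · g both have all phases 1, then `hcs` forces the torus part of g to be 1.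
  have hmem : ∀ a b : Q, A.div a.1 b.1 ∈ TorusPerm.permSubgroup n := fun a b => by
    by_cases h : A.proj a.1 = A.proj b.1
    · refine TorusPerm.mem_permSubgroup_iff.2 (funext fun j => ?_)
      obtain ⟨i, rfl⟩ := (A.div a.1 b.1).right.surjective j
      have := hcs (A.div a.1 b.1) a.1 i
      rw [A.smul_div h, a.2, b.2] at this
      simpa using this.symm
    · rw [div, dif_neg h]
      exact one_mem _
  -- Moving a by its inverse phases lands in Q. This turns local sections of A into local sections
  -- of Q.
  let ρ : A.P → Q := fun a => ⟨op (⟨(c a)⁻¹, 1⟩ : TorusPerm n) • a, funext fun i => by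
    rw [hcs]
    simp⟩
  have hρ : Continuous ρ := by
    have h1 : Continuous fun a : A.P => (⟨(c a)⁻¹, 1⟩ : TorusPerm n) :=
      TorusPerm.continuous_of hc.inv (IsLocallyConstant.const 1)
    exact ((MulOpposite.continuous_op.comp h1).smul continuous_id).subtype_mk _
  let B : PrincipalBundle (TorusPerm.permSubgroup n) X :=
    ofDivision (P := Q) (proj := fun a => A.proj a.1)
      (A.continuous_proj.comp continuous_subtype_val) (fun g a => A.proj_smul g a.1)
      (fun a b => ⟨A.div a.1 b.1, hmem a b⟩) (fun a b h => Subtype.ext (A.smul_div h))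
      (fun a g => Subtype.ext (A.smul_right_injective a.1
        (A.smul_div (A.proj_smul (g : TorusPerm n) a.1).symm)))
      (by
        refine Continuous.subtype_mk (A.continuous_div.comp
          (f := fun p : {p : Q × Q // A.proj p.1.1 = A.proj p.2.1} =>
            (⟨(p.1.1.1, p.1.2.1), p.2⟩ : {p : A.P × A.P // A.proj p.1 = A.proj p.2})) ?_) _
        have hval : Continuous (Subtype.val : Q → A.P) := continuous_subtype_val
        exact ((hval.comp (continuous_fst.comp continuous_subtype_val)).prodMk
          (hval.comp (continuous_snd.comp continuous_subtype_val))).subtype_mk _)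
      fun x => by
        obtain ⟨e, he⟩ := A.exists_trivialization x
        refine ⟨e.baseSet, fun y => ρ (e.toOpenPartialHomeomorph.symm (y, 1)), e.open_baseSet, he,
          hρ.comp_continuousOn e.continuousOn_symm_prodMk_left, fun y hy => ?_⟩
        exact (A.proj_smul _ _).trans (e.proj_symm_apply' hy)
  exact ⟨B, Subtype.val, continuous_subtype_val, fun _ => rfl, fun _ _ => rfl⟩

end PrincipalBundle

namespace TwistedCovering

open MulOpposite (op)
open PrincipalBundle (Assoc)

variable {n : ℕ} {X : Type u} [TopologicalSpace X] {T : TwistedCovering n X}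
  {A : PrincipalBundle (TorusPerm n) X}

/-- A global unit section of L differs from the vector [a, (i, 1)] by a phase c(a)_i, and these
phases are equivariant. -/
theorem IsAssociatedTo.reducesTo [T2Space X] [LocallyCompactSpace X] (hT : T.IsAssociatedTo A)
    (h : T.TwistTrivial) : A.ReducesTo (TorusPerm.permSubgroup n) := by
  obtain ⟨u, hu, hu1⟩ := T.L.isomorphic_trivial_iff.1 h
  obtain ⟨h, k, hs, hk⟩ := hT
  -- All scalars w are needed, since g turns (i, 1) into a pair whose scalar is a phase.
  have hc : ∀ a i, ∃ c : Circle, ∀ w : ℂ, k (.mk A a (i, w)) =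
      ⟨h (.mk A a i), (w * c) • u (h (.mk A a i))⟩ := fun a i => by
    obtain ⟨v, hv, hkv⟩ := hk a i
    refine ⟨⟨T.L.metric _ (u _) v, mem_sphere_zero_iff_norm.2
      (T.L.norm_metric_eq_one (hu1 _) hv)⟩, fun w => ?_⟩
    rw [hkv, mul_smul]
    exact congrArg (fun v' => (⟨_, w • v'⟩ : T.L.Tot)) (T.L.metric_smul_eq (hu1 _) v).symm
  choose c hc using hc
  have hci : ∀ a i w, (w * c a i : ℂ) = T.L.inner ⟨_, u (h (.mk A a i))⟩ (k (.mk A a (i, w))) :=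
    fun a i w => by
      rw [hc, T.L.inner_mk, map_smul, hu1, smul_eq_mul, mul_one]
  refine A.reducesTo_of_phase c (continuous_pi fun i => continuous_induced_rng.2 ?_) fun g a i => ?_
  · have h1 : ∀ {F : Type} [TopologicalSpace F] [MulAction (TorusPerm n) F]
        [ContinuousSMul (TorusPerm n) F] (t : F), Continuous fun a => Assoc.mk A a t := fun t =>
      (Assoc.continuous_mk A).comp (continuous_id.prodMk continuous_const)
    refine (T.L.continuous_inner (hu.comp (h.continuous.comp (h1 i)))
      (k.continuous.comp (h1 (i, 1))) fun a => ?_).congr fun a => ?_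
    · rw [Function.comp_apply, Function.comp_apply, hc]
      rfl
    · exact (hci a i 1).symm.trans (one_mul _)
  · refine Circle.ext ?_
    rw [← one_mul ((c (op g • a) i : Circle) : ℂ), hci, Assoc.mk_smul, Assoc.mk_smul,
      TorusPerm.smul_prod_def, Circle.coe_mul]
    dsimp only
    rw [mul_one, TorusPerm.smul_fin_def, ← hci]

/-- Representatives of a point of Z taken from Q differ by permutations without phases, so the
vectors [f q, (i, 1)] define a global unit section. -/
theorem IsAssociatedTo.twistTrivial (hT : T.IsAssociatedTo A)
    (hA : A.ReducesTo (TorusPerm.permSubgroup n)) : T.TwistTrivial := by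
  refine T.L.isomorphic_trivial_iff.2 ?_
  obtain ⟨h, k, hs, hk⟩ := hT
  obtain ⟨Q, f, hf, hfp, hfs⟩ := hA
  have hs' : ∀ q, T.s (h q) = Assoc.proj A _ q := fun q => by
    obtain ⟨a, i, rfl⟩ := Assoc.mk_surjective A q
    exact hs a i
  have hrep : ∀ z q, Q.proj q = T.s z → ∃ i, h (.mk A (f q) i) = z := fun z q hq => by
    obtain ⟨i, hi⟩ := Assoc.exists_rep_of_proj_eq A (q := h.symm z) (a := f q)
      (by rw [← hs', h.apply_symm_apply, hfp, hq])
    exact ⟨i, by rw [hi, h.apply_symm_apply]⟩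
  have hwd : ∀ q q' i i', h (.mk A (f q) i) = h (.mk A (f q') i') →
      k (.mk A (f q) (i, 1)) = k (.mk A (f q') (i', 1)) := fun q q' i i' hqq => by
    obtain ⟨η, rfl⟩ := Q.exists_smul_eq (a := q) (b := q') (by
      rw [← hfp, ← hfp, ← hs, hqq, hs])
    have hη := TorusPerm.mem_permSubgroup_iff.1 η.2
    rw [hfs, Assoc.mk_smul] at hqq ⊢
    obtain rfl := Assoc.mk_right_injective A (h.injective hqq)
    rw [TorusPerm.smul_prod_def, hη]
    simp [TorusPerm.smul_fin_def]
  have hex : ∀ z, ∃ u : T.L.E z, T.L.metric z u u = 1 ∧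
      ∀ q i, h (.mk A (f q) i) = z → k (.mk A (f q) (i, 1)) = ⟨z, u⟩ := fun z => by
    obtain ⟨q, hq⟩ := Q.surjective_proj (T.s z)
    obtain ⟨i, rfl⟩ := hrep z q hq
    obtain ⟨u, hu, hku⟩ := hk (f q) i
    refine ⟨u, hu, fun q' i' hqi => ?_⟩
    rw [hwd q' q i' i hqi, hku, one_smul]
  choose u hu1 hu using hex
  refine ⟨u, continuous_iff_continuousAt.2 fun z => ?_, hu1⟩
  obtain ⟨e, he⟩ := Q.exists_trivialization (T.s z)
  have hsc : Continuous T.s := T.isCoveringMap.continuous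
  have hVo : IsOpen (T.s ⁻¹' e.baseSet) := e.open_baseSet.preimage hsc
  have hτ : Continuous fun y : T.s ⁻¹' e.baseSet => e.toOpenPartialHomeomorph.symm (T.s y, 1) :=
    e.continuousOn_symm_prodMk_left.comp_continuous (hsc.comp continuous_subtype_val) fun y => y.2
  choose i hi using fun y : T.s ⁻¹' e.baseSet => hrep y _ (e.proj_symm_apply' (x := 1) y.2)
  have hmk : ∀ {F : Type} [TopologicalSpace F] [MulAction (TorusPerm n) F]
      [ContinuousSMul (TorusPerm n) F] {t : T.s ⁻¹' e.baseSet → F} (_ : Continuous t),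
      Continuous fun y : T.s ⁻¹' e.baseSet =>
        Assoc.mk A (f (e.toOpenPartialHomeomorph.symm (T.s y, 1))) (t y) := fun ht =>
    (Assoc.continuous_mk A).comp ((hf.comp hτ).prodMk ht)
  -- Along a local section of Q, the position of y in its fiber is locally constant, so the unit
  -- section is locally a continuous expression in y.
  have hic : Continuous i := by
    refine (isLocallyConstant_of_isClosed_fibers fun j => ?_).continuous
    have : {y | i y = j} = {y : T.s ⁻¹' e.baseSet |
        h (.mk A (f (e.toOpenPartialHomeomorph.symm (T.s y, 1))) j) = y} := by
      ext y
      refine ⟨fun hy => ?_, fun hy => ?_⟩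
      · rw [Set.mem_ofPred_eq, ← hy, hi]
      · exact Assoc.mk_right_injective A (h.injective ((hi y).trans hy.symm))
    rw [this]
    exact isClosed_eq (h.continuous.comp (hmk continuous_const)) continuous_subtype_val
  have h1 : ContinuousOn (fun z => (⟨z, u z⟩ : T.L.Tot)) (T.s ⁻¹' e.baseSet) :=
    continuousOn_iff_continuous_domRestrict.2
      ((k.continuous.comp (hmk (hic.prodMk continuous_const))).congr fun y => hu _ _ _ (hi y))
  exact h1.continuousAt (hVo.mem_nhds he)

end TwistedCovering

theorem mainTheorem1 (n : ℕ) (hn : 0 < n)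
    (X : Type u) [TopologicalSpace X] [LocallyCompactSpace X] [T2Space X] :
    (∃ Φ : TorusPerm n ≃ₜ* unitaryNormalizer n, ∀ (g : TorusPerm n) (i j : Fin n),
      ((Φ g : Matrix.unitaryGroup (Fin n) ℂ) : Matrix (Fin n) (Fin n) ℂ) i j =
        if i = g.right j then (g.left i : ℂ) else 0) ∧
    ∃ Θ : Quotient (TwistedCovering.isoSetoid n X) ≃
        Quotient (PrincipalBundle.isoSetoid (TorusPerm n) X),
      (∀ (T : TwistedCovering n X) (A : PrincipalBundle (TorusPerm n) X),
        Θ ⟦T⟧ = ⟦A⟧ ↔ T.IsAssociatedTo A) ∧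
      ∀ (T : TwistedCovering n X) (A : PrincipalBundle (TorusPerm n) X),
        Θ ⟦T⟧ = ⟦A⟧ → (T.TwistTrivial ↔ A.ReducesTo (TorusPerm.permSubgroup n)) := by
  have : NeZero n := ⟨hn.ne'⟩
  refine ⟨⟨TorusPerm.equivNormalizer n, fun g i j => TorusPerm.toMatrix_apply g i j⟩, ?_⟩
  let θ : Quotient (TwistedCovering.isoSetoid n X) →
      Quotient (PrincipalBundle.isoSetoid (TorusPerm n) X) :=
    Quotient.map TwistedCovering.frameBundle fun _ _ h => TwistedCovering.Iso.frameBundle_iso h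
  have hθ : ∀ (T : TwistedCovering n X) (A : PrincipalBundle (TorusPerm n) X),
      θ ⟦T⟧ = ⟦A⟧ ↔ T.IsAssociatedTo A := fun T A => by
    refine Quotient.eq.trans ⟨fun h => ?_, fun h => ?_⟩
    · exact T.isAssociatedTo_frameBundle.of_iso (Setoid.symm h)
    · exact Setoid.symm h.iso_frameBundle
  have hbij : Function.Bijective θ := by
    constructor
    · rintro ⟨S⟩ ⟨T⟩ h
      -- As θ⟦T⟧ is the class of the frame bundle of T, both S and T are associated to that bundle.
      exact Quotient.sound (TwistedCovering.iso_of_isAssociatedTo ((hθ S T.frameBundle).1 h)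
        T.isAssociatedTo_frameBundle)
    · rintro ⟨A⟩
      exact ⟨⟦A.twistedCovering⟧, (hθ _ A).2 A.isAssociatedTo_twistedCovering⟩
  exact ⟨Equiv.ofBijective θ hbij, hθ, fun T A h =>
    ⟨((hθ T A).1 h).reducesTo, ((hθ T A).1 h).twistTrivial⟩⟩
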